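/- **Setting.** Let $n\ge 2$ and let $H_n=\mathbb R^{2n+1}$, with coordinates $(x_1,\dots,x_n,y_1,\dots,y_n,t)$, be the Heisenberg group, with contact form $\Theta=dt+\sum_j(x_jdy_j-y_jdx_j)$, contact bundle $\xi=\ker\Theta$, left invariant frame $\mathring e_j=\partial_{x_j}+y_j\partial_t$, $\mathring e_{n+j}=\partial_{y_j}-x_j\partial_t$ $(1\le j\le n)$ of $\xi$, $T=\partial_t$, almost complex structure $J\mathring e_j=\mathring e_{n+j}$, $J\mathring e_{n+j}=-\mathring e_j$, Levi metric $\langle\cdot,\cdot\rangle$ on $\xi$ (for which $\mathring e_1,\dots,\mathring e_{2n}$ is orthonormal), and pseudohermitian connection $\nabla$ (for which $\mathring e_1,\dots,\mathring e_{2n},T$ are parallel). Let $\Sigma$ be an immersed $C^2$ hypersurface (without boundary) of $H_n$. A point $p\in\Sigma$ is *singular* if $T_p\Sigma=\xi_p$, and *regular* otherwise; $S_\Sigma$ is the set of singular points, and $\Sigma\setminus S_\Sigma$ is assumed to be $C^\infty$. At regular points let $\xi'=(\xi\cap T\Sigma)\cap J(\xi\cap T\Sigma)$, let $e_n$ be a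 continuous field of unit vectors in $\xi\cap T\Sigma$ perpendicular to $\xi'$ (at each point it is unique up to sign), let $e_{2n}=Je_n$, and define the functions $\alpha$ and $l$ by $\alpha e_{2n}+T\in T\Sigma$ and $-\nabla_{e_n}e_{2n}\equiv l\,e_n \bmod \xi'$. Let $J'=J$ on $\xi'$ and $J'e_n=0$, and let $\mathfrak S(v)=-\nabla_v e_{2n}+\alpha J'v$ for $v\in\xi\cap T\Sigma$. The $p$-mean curvature $H$ is the trace of $v\mapsto-\nabla_ve_{2n}$ on $\xi\cap T\Sigma$, i.e. $H=\sum_a\langle-\nabla_{v_a}e_{2n},v_a\rangle$ for an orthonormal basis $(v_a)$ of $\xi\cap T\Sigma$. The hypersurface $\Sigma$ is *umbilic* if at every regular point $\mathfrak S(\xi')\subset\xi'$ and all eigenvalues of $\mathfrak S|_{\xi'}$ coincide; their common value is denoted $k$. **Lemma B.** Suppose $\Sigma$ is a connected umbilic hypersurface of $H_n$ $(n\ge2)$ whose $p$-mean curvature, for a suitable choice of the field $e_n$ on $\Sigma\setminus S_\Sigma$, is a positive constant, and suppose $\Sigma$ contains a singular point. Then, for this choice of $e_n$, $l=2k$ on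 $\Sigma\setminus S_\Sigma$. -/

import Mathlib

open scoped Manifold ContDiff Topology

noncomputable section

namespace Heisenberg

/-- Horizontal coefficient vectors `(a¹, …, a²ⁿ)`: the entry `inl j` is the coefficient of
`e̊_j = ∂/∂x_j + y_j ∂/∂t`, the entry `inr j` that of `e̊_{n+j} = ∂/∂y_j - x_j ∂/∂t`. In this
left invariant orthonormal frame the Levi metric `∑ (dx_j)² + (dy_j)²` on the contact planes is
the Euclidean inner product of coefficient vectors. -/
abbrev Hor (n : ℕ) : Type := EuclideanSpace ℝ (Fin n ⊕ Fin n)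

/-- The manifold underlying the Heisenberg group `H_n`: points `((x, y), t)` of `ℝ²ⁿ⁺¹`. -/
abbrev Heis (n : ℕ) : Type := Hor n × ℝ

/-- The `CR` structure in the left invariant frame: `J e̊_j = e̊_{n+j}`, `J e̊_{n+j} = -e̊_j`. -/
def J (n : ℕ) : Hor n →ₗ[ℝ] Hor n where
  toFun a := WithLp.toLp 2 (Sum.elim (fun j => -a (Sum.inr j)) (fun j => a (Sum.inl j)))
  map_add' a b := by
    ext i
    cases i <;> simp [add_comm]
  map_smul' r a := by
    ext i
    cases i <;> simp

/-- The tangent vector `∑ a_j e̊_j + a_{n+j} e̊_{n+j}` at the point `q`. -/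
def frame {n : ℕ} (q : Heis n) : Hor n →ₗ[ℝ] Heis n where
  toFun a := (a, ∑ j, (q.1 (Sum.inr j) * a (Sum.inl j) - q.1 (Sum.inl j) * a (Sum.inr j)))
  map_add' a b := by
    ext
    · simp
    · simp only [PiLp.add_apply, Prod.snd_add, ← Finset.sum_add_distrib]
      exact Finset.sum_congr rfl fun j _ => by ring
  map_smul' r a := by
    ext
    · simp
    · simp only [PiLp.smul_apply, smul_eq_mul, Prod.smul_snd, Finset.mul_sum, RingHom.id_apply]
      exact Finset.sum_congr rfl fun j _ => by ring

/-- The Reeb vector field `T = ∂/∂t`. -/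
def reeb (n : ℕ) : Heis n := (0, 1)

/-- The contact form `Θ = dt + ∑ (x_j dy_j - y_j dx_j)` at the point `q`. -/
def contactForm {n : ℕ} (q : Heis n) : Heis n →ₗ[ℝ] ℝ where
  toFun v := v.2 + ∑ j, (q.1 (Sum.inl j) * v.1 (Sum.inr j) - q.1 (Sum.inr j) * v.1 (Sum.inl j))
  map_add' a b := by
    have : ∑ j, (q.1 (Sum.inl j) * (a + b).1 (Sum.inr j)
          - q.1 (Sum.inr j) * (a + b).1 (Sum.inl j)) =
        ∑ j, (q.1 (Sum.inl j) * a.1 (Sum.inr j) - q.1 (Sum.inr j) * a.1 (Sum.inl j)) +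
        ∑ j, (q.1 (Sum.inl j) * b.1 (Sum.inr j) - q.1 (Sum.inr j) * b.1 (Sum.inl j)) := by
      rw [← Finset.sum_add_distrib]
      refine Finset.sum_congr rfl fun j _ => ?_
      simp only [Prod.fst_add, PiLp.add_apply]
      ring
    rw [this, Prod.snd_add]
    ring
  map_smul' r a := by
    simp only [Prod.smul_snd, Prod.smul_fst, PiLp.smul_apply, smul_eq_mul, RingHom.id_apply,
      mul_add, Finset.mul_sum]
    congr 1
    exact Finset.sum_congr rfl fun j _ => by ring

/-- The contact plane `ξ_q = ker Θ_q`. -/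
def contactPlane {n : ℕ} (q : Heis n) : Submodule ℝ (Heis n) :=
  LinearMap.ker (contactForm q)

/-- The contact plane is the span of the left invariant horizontal frame. -/
theorem contactPlane_eq_range_frame {n : ℕ} (q : Heis n) :
    contactPlane q = LinearMap.range (frame q) := by
  ext v
  constructor
  · intro hv
    refine ⟨v.1, Prod.ext rfl ?_⟩
    have h : v.2 + ∑ j, (q.1 (Sum.inl j) * v.1 (Sum.inr j)
        - q.1 (Sum.inr j) * v.1 (Sum.inl j)) = 0 := hv
    change ∑ j, (q.1 (Sum.inr j) * v.1 (Sum.inl j) - q.1 (Sum.inl j) * v.1 (Sum.inr j)) = v.2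
    rw [eq_neg_of_add_eq_zero_left h, ← Finset.sum_neg_distrib]
    exact Finset.sum_congr rfl fun j _ => by ring
  · rintro ⟨a, rfl⟩
    change ∑ j, (q.1 (Sum.inr j) * a (Sum.inl j) - q.1 (Sum.inl j) * a (Sum.inr j)) +
      ∑ j, (q.1 (Sum.inl j) * a (Sum.inr j) - q.1 (Sum.inr j) * a (Sum.inl j)) = 0
    rw [← Finset.sum_add_distrib]
    exact Finset.sum_eq_zero fun j _ => by ring

section Hypersurface

variable {n : ℕ} {M : Type*} [TopologicalSpace M]
  [ChartedSpace (EuclideanSpace ℝ (Fin (2 * n))) M]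

/-- The differential of `F : M → H_n` at `p`. -/
def differential (F : M → Heis n) (p : M) :
    TangentSpace (𝓡 (2 * n)) p →L[ℝ] Heis n :=
  mfderiv (𝓡 (2 * n)) 𝓘(ℝ, Heis n) F p

/-- The tangent hyperplane of the immersed hypersurface at `p`, inside `ℝ²ⁿ⁺¹`. -/
def tangentPlane (F : M → Heis n) (p : M) : Submodule ℝ (Heis n) :=
  LinearMap.range (differential F p).toLinearMap

/-- `p` is singular if the tangent hyperplane at `p` is the contact plane. -/
def IsSingular (F : M → Heis n) (p : M) : Prop :=
  tangentPlane F p = contactPlane (F p)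

/-- `p` is regular if it is not singular. -/
def IsRegular (F : M → Heis n) (p : M) : Prop := ¬ IsSingular F p

/-- `F` immerses the `2n`-manifold `M` as a `C²` hypersurface of `H_n` whose regular part is
`C^∞`: near a regular point the hypersurface lies on a level set of a `C^∞` function with
nonvanishing differential. -/
structure IsImmersedHypersurface (F : M → Heis n) : Prop where
  contMDiff : ContMDiff (𝓡 (2 * n)) 𝓘(ℝ, Heis n) 2 F
  injective_differential : ∀ p, Function.Injective (differential F p)
  smooth_regular : ∀ p, IsRegular F p →
    ∃ u : Heis n → ℝ, ContDiff ℝ ∞ u ∧ fderiv ℝ u (F p) ≠ 0 ∧ ∀ᶠ q in 𝓝 p, u (F q) = 0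

/-- `ξ ∩ TΣ` at `p`, in the left invariant frame. -/
def horTangent (F : M → Heis n) (p : M) : Submodule ℝ (Hor n) :=
  (tangentPlane F p).comap (frame (F p))

/-- `ξ' = (ξ ∩ TΣ) ∩ J (ξ ∩ TΣ)` at `p`, in the left invariant frame. -/
def xiPrime (F : M → Heis n) (p : M) : Submodule ℝ (Hor n) :=
  horTangent F p ⊓ (horTangent F p).map (J n)

/-- `e` is a choice of the characteristic field `e_n` on the regular part: a continuous field of
unit vectors in `(ξ ∩ TΣ) ∩ (ξ')^⊥`. As this space is a line, `e` is unique up to a sign on each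
component of the regular part, and it inherits the smoothness of the tangent planes. -/
structure IsCharacteristicField (F : M → Heis n) (e : M → Hor n) : Prop where
  continuousOn : ContinuousOn e {p | IsRegular F p}
  mem_horTangent : ∀ p, IsRegular F p → e p ∈ horTangent F p
  mem_orthogonal : ∀ p, IsRegular F p → e p ∈ (xiPrime F p)ᗮ
  norm_eq_one : ∀ p, IsRegular F p → ‖e p‖ = 1

/-- The horizontal normal `e_{2n} = J e_n`. -/
def horNormal (e : M → Hor n) (p : M) : Hor n := J n (e p)

/-- The covariant derivative `∇_v Y` at `p` of a horizontal field `Y` along the hypersurface in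
the direction `v ∈ ξ ∩ TΣ`, for the pseudohermitian connection. The left invariant frame is
parallel, so this is the derivative of the coefficients of `Y` along the tangent vector of `M`
which the differential of `F` maps to `v`. -/
def covDeriv (F : M → Heis n) (Y : M → Hor n) (p : M) (v : Hor n) : Hor n :=
  mfderiv (𝓡 (2 * n)) 𝓘(ℝ, Hor n) Y p
    (Function.invFun (differential F p) (frame (F p) v) : TangentSpace (𝓡 (2 * n)) p)

/-- The function `α` on the regular part: the number with `α e_{2n} + T ∈ TΣ`. -/
def alpha (F : M → Heis n) (e : M → Hor n) (p : M) : ℝ :=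
  Classical.epsilon fun a : ℝ => a • frame (F p) (horNormal e p) + reeb n ∈ tangentPlane F p

/-- `J'` on `ξ ∩ TΣ`: equal to `J` on `ξ'`, and `J' e_n = 0`. -/
def JPrime (e : M → Hor n) (p : M) (v : Hor n) : Hor n :=
  J n (v - inner ℝ (e p) v • e p)

/-- The shape operator `v ↦ -∇_v e_{2n} + α J' v` on `ξ ∩ TΣ`. -/
def shapeOp (F : M → Heis n) (e : M → Hor n) (p : M) (v : Hor n) : Hor n :=
  -covDeriv F (horNormal e) p v + alpha F e p • JPrime e p v

/-- `k` is an eigenvalue at `p` of the shape operator on `ξ'`. -/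
def IsEigenvalue (F : M → Heis n) (e : M → Hor n) (p : M) (k : ℝ) : Prop :=
  ∃ v ∈ xiPrime F p, v ≠ 0 ∧ shapeOp F e p v = k • v

/-- `p` is umbilic: the shape operator preserves `ξ'`, and its eigenvalues there coincide. -/
structure IsUmbilicPoint (F : M → Heis n) (e : M → Hor n) (p : M) : Prop where
  invariant : ∀ v ∈ xiPrime F p, shapeOp F e p v ∈ xiPrime F p
  eigenvalue_unique : ∀ k k' : ℝ, IsEigenvalue F e p k → IsEigenvalue F e p k' → k = k'

/-- All regular points are umbilic. -/
def IsUmbilicHypersurface (F : M → Heis n) (e : M → Hor n) : Prop :=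
  ∀ p, IsRegular F p → IsUmbilicPoint F e p

/-- The function `l` with `-∇_{e_n} e_{2n} = l e_n` modulo `ξ'`. -/
def ell (F : M → Heis n) (e : M → Hor n) (p : M) : ℝ :=
  inner ℝ (-covDeriv F (horNormal e) p (e p)) (e p)

/-- The `p`-mean curvature: the trace over `ξ ∩ TΣ` of `II(X, Y) = -⟨∇_Y e_{2n}, X⟩`. -/
def pMeanCurvature (F : M → Heis n) (e : M → Hor n) (p : M) : ℝ :=
  ∑ a, inner ℝ
    (-covDeriv F (horNormal e) p (stdOrthonormalBasis ℝ (horTangent F p) a : Hor n))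
    (stdOrthonormalBasis ℝ (horTangent F p) a : Hor n)

end Hypersurface

end Heisenberg

end

noncomputable section

namespace Heisenberg

/-! ### Linear algebra of `J`, the frame and the contact form. -/

section Algebra

variable {n : ℕ}

/-! Umbilicity and `H = c` reduce the derivative of the horizontal normal `N = e_{2n}` along `ξ ∩
TΣ` to `l` and `α`: `D_v N = -k v + α J v` on `ξ'` and `D_{e_n} N = -l e_n`, with `c = l + (2n - 2)
k` (`IsAdapted.exists_normal_form`). So `l = 2k` is the equation `n l = c`, and the task is to show
that `f = n l - c` vanishes.

Symmetry of the second derivative of `N` gives `v l = 0` on `ξ'` and `e_n l = -2 f α` (`codazzi`).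
Commuting `v` with `J v` then gives `(T + α e_{2n} + k e_n) l = 0` (`codazzi_vertical`). Hence every
tangential derivative of `l` is a multiple of `f`, and along curves `f` solves a homogeneous linear
equation (`hasDerivAt_ell`). Zeros of `f` therefore spread through the regular part
(`eventually_ell_eq`).

The zeros come from the singular point. There `Σ` is the graph of a `C²` function `u` whose
horizontal gradient `G` vanishes at the singular point. Up to sign, `|G| k` and `|G| l` are entries
of `DG`, hence bounded, while `|G| c` tends to `0`. Passing to the limit along rays gives the
symmetric part of `DG` a normal form with trace relation `μ = -(2n - 2) κ`, relative to every
nonzero vector in the image of `DG`; linear algebra then makes this part zero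
(`eq_zero_of_hasLimitForm`). So `DG = J` at the singular point, `G` is close to `J (z - z₀)`, and
along a ray `f' = -a f` with `a` close to `2n / s`. A nonzero solution would blow up faster than the
bound `f = O(1 / s)` permits, so `f = 0` near the singular point
(`eventually_ell_eq_of_isSingular`). Connectedness of `M` does the rest. -/

theorem J_J (v : Hor n) : J n (J n v) = -v := by
  ext i
  cases i <;> simp [J]

theorem inner_J_left (v w : Hor n) : inner ℝ (J n v) w = -inner ℝ v (J n w) := by
  simp [PiLp.inner_apply, J, Fintype.sum_sum_type, Finset.sum_neg_distrib]

theorem inner_J_right (v w : Hor n) : inner ℝ v (J n w) = -inner ℝ (J n v) w := by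
  rw [inner_J_left, neg_neg]

theorem inner_J_J (v w : Hor n) : inner ℝ (J n v) (J n w) = inner ℝ v w := by
  rw [inner_J_left, J_J, inner_neg_right, neg_neg]

theorem inner_J_self (v : Hor n) : inner ℝ v (J n v) = 0 := by
  have h := inner_J_left v v
  rw [real_inner_comm] at h
  linarith

theorem inner_J_self' (v : Hor n) : inner ℝ (J n v) v = 0 := by
  rw [inner_J_left, inner_J_self, neg_zero]

theorem norm_J (v : Hor n) : ‖J n v‖ = ‖v‖ := by
  rw [← sq_eq_sq₀ (norm_nonneg _) (norm_nonneg _), ← real_inner_self_eq_norm_sq,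
    ← real_inner_self_eq_norm_sq, inner_J_J]

/-- `J` as a continuous linear map. -/
def JL (n : ℕ) : Hor n →L[ℝ] Hor n := LinearMap.toContinuousLinearMap (J n)

@[simp]
theorem JL_apply (v : Hor n) : JL n v = J n v := rfl

theorem frame_apply (q : Heis n) (v : Hor n) : frame q v = (v, inner ℝ q.1 (J n v)) := by
  ext1
  · rfl
  · simp [frame, PiLp.inner_apply, J, Fintype.sum_sum_type, Finset.sum_sub_distrib,
      Finset.sum_neg_distrib]
    simp [mul_comm]
    ring

theorem contactForm_apply (q X : Heis n) :
    contactForm q X = X.2 - inner ℝ q.1 (J n X.1) := by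
  simp [contactForm, PiLp.inner_apply, J, Fintype.sum_sum_type, Finset.sum_sub_distrib,
    Finset.sum_neg_distrib]
  simp [mul_comm]
  ring

theorem eq_frame_add (q X : Heis n) :
    X = frame q X.1 + contactForm q X • reeb n := by
  rw [frame_apply, contactForm_apply]
  ext1 <;> simp [reeb]

theorem contactForm_frame (q : Heis n) (v : Hor n) : contactForm q (frame q v) = 0 := by
  simp [contactForm_apply, frame_apply]

theorem finrank_Hor : Module.finrank ℝ (Hor n) = 2 * n := by
  simp [two_mul]

theorem finrank_Heis : Module.finrank ℝ (Heis n) = 2 * n + 1 := by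
  rw [Module.finrank_prod, finrank_Hor, Module.finrank_self]

theorem finrank_contactPlane (q : Heis n) : Module.finrank ℝ (contactPlane q) = 2 * n := by
  rw [contactPlane_eq_range_frame, LinearMap.finrank_range_of_inj, finrank_Hor]
  intro v w h
  simpa [frame_apply] using congrArg Prod.fst h

/-- The vectors orthogonal to `ν` and `J ν` contain a nonzero vector when `n ≥ 2`. -/
theorem exists_ne_zero_orthogonal (hn : 2 ≤ n) (ν : Hor n) :
    ∃ v : Hor n, v ≠ 0 ∧ inner ℝ ν v = 0 ∧ inner ℝ (J n ν) v = 0 := by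
  let A : Hor n →ₗ[ℝ] ℝ × ℝ :=
    (innerSL ℝ ν).toLinearMap.prod (innerSL ℝ (J n ν)).toLinearMap
  have hk : LinearMap.ker A ≠ ⊥ := by
    apply LinearMap.ker_ne_bot_of_finrank_lt
    rw [finrank_Hor, Module.finrank_prod, Module.finrank_self]
    omega
  obtain ⟨v, hv, h0⟩ := (Submodule.ne_bot_iff _).1 hk
  have : A v = 0 := hv
  exact ⟨v, h0, congrArg Prod.fst this, congrArg Prod.snd this⟩

end Algebra

/-! ### Horizontal gradients and their derivatives. -/

section Gradient

variable {n : ℕ}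

/-- The horizontal gradient of `U`, in the left invariant frame. -/
def hgrad (U : Heis n → ℝ) (q : Heis n) : Hor n :=
  ∑ i, fderiv ℝ U q (frame q (EuclideanSpace.basisFun (Fin n ⊕ Fin n) ℝ i)) •
    EuclideanSpace.basisFun (Fin n ⊕ Fin n) ℝ i

theorem inner_hgrad (U : Heis n → ℝ) (q : Heis n) (v : Hor n) :
    inner ℝ (hgrad U q) v = fderiv ℝ U q (frame q v) := by
  conv_rhs => rw [← (EuclideanSpace.basisFun (Fin n ⊕ Fin n) ℝ).sum_repr' v]
  simp only [hgrad, sum_inner, real_inner_smul_left, map_sum, map_smul, smul_eq_mul]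
  exact Finset.sum_congr rfl fun i _ => mul_comm _ _

theorem hgrad_neg (U : Heis n → ℝ) (q : Heis n) : hgrad (fun x => -U x) q = -hgrad U q := by
  simp [hgrad, fderiv_fun_neg]

/-- The unit horizontal normal of the level sets of `U`. -/
def unitGrad (U : Heis n → ℝ) (q : Heis n) : Hor n := ‖hgrad U q‖⁻¹ • hgrad U q

theorem hgrad_eq_norm_smul (U : Heis n → ℝ) (q : Heis n) :
    hgrad U q = ‖hgrad U q‖ • unitGrad U q := by
  by_cases h : hgrad U q = 0
  · simp [h]
  · rw [unitGrad, smul_inv_smul₀ (norm_ne_zero_iff.2 h)]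

theorem norm_unitGrad {U : Heis n → ℝ} {q : Heis n} (h : hgrad U q ≠ 0) :
    ‖unitGrad U q‖ = 1 := by
  rw [unitGrad, norm_smul, norm_inv, norm_norm, inv_mul_cancel₀ (norm_ne_zero_iff.2 h)]

theorem contDiff_frame_apply {m : WithTop ℕ∞} {V : Heis n → Hor n} {q : Heis n}
    (hV : ContDiffAt ℝ m V q) : ContDiffAt ℝ m (fun x => frame x (V x)) q := by
  have : (fun x => frame x (V x)) = fun x : Heis n => (V x, inner ℝ x.1 (JL n (V x))) :=
    funext fun x => frame_apply x _
  rw [this]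
  exact hV.prodMk (contDiffAt_fst.inner ℝ ((JL n).contDiff.contDiffAt.comp q hV))

theorem contDiffAt_hgrad {m k : WithTop ℕ∞} {U : Heis n → ℝ} {q : Heis n}
    (hU : ContDiffAt ℝ k U q) (hmk : m + 1 ≤ k) : ContDiffAt ℝ m (hgrad U) q := by
  unfold hgrad
  refine ContDiffAt.sum fun i _ => ContDiffAt.fun_smul ?_ contDiffAt_const
  exact (hU.fderiv_right hmk).clm_apply (contDiff_frame_apply contDiffAt_const)

theorem contDiffAt_unitGrad {m k : WithTop ℕ∞} {U : Heis n → ℝ} {q : Heis n}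
    (hU : ContDiffAt ℝ k U q) (hmk : m + 1 ≤ k) (h : hgrad U q ≠ 0) :
    ContDiffAt ℝ m (unitGrad U) q := by
  have hG := contDiffAt_hgrad hU hmk
  exact ((hG.norm ℝ h).inv (norm_ne_zero_iff.2 h)).smul hG

/-- The derivative of a frame vector field `V`. -/
theorem hasFDerivAt_frame_apply {V : Heis n → Hor n} {q : Heis n}
    {V' : Heis n →L[ℝ] Hor n} (hV : HasFDerivAt V V' q) (X : Heis n) :
    DifferentiableAt ℝ (fun x => frame x (V x)) q ∧
    fderiv ℝ (fun x => frame x (V x)) q X =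
      frame q (V' X) + inner ℝ X.1 (J n (V q)) • reeb n := by
  have : (fun x => frame x (V x)) = fun x : Heis n => (V x, inner ℝ x.1 (JL n (V x))) :=
    funext fun x => frame_apply x _
  rw [this]
  have h := hV.prodMk ((hasFDerivAt_fst (𝕜 := ℝ) (p := q)).inner ℝ
    ((JL n).hasFDerivAt.comp q hV))
  refine ⟨h.differentiableAt, ?_⟩
  erw [h.fderiv]
  simp [frame_apply, reeb]

/-- The derivative of the horizontal gradient. -/
theorem inner_fderiv_hgrad {U : Heis n → ℝ} {q : Heis n} (hU : ContDiffAt ℝ 2 U q)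
    (X : Heis n) (w : Hor n) :
    inner ℝ (fderiv ℝ (hgrad U) q X) w =
      fderiv ℝ (fderiv ℝ U) q X (frame q w) +
        inner ℝ X.1 (J n w) * fderiv ℝ U q (reeb n) := by
  have hG : DifferentiableAt ℝ (hgrad U) q :=
    (contDiffAt_hgrad (m := 1) hU (by norm_num)).differentiableAt (by norm_num)
  have hD : DifferentiableAt ℝ (fderiv ℝ U) q :=
    (hU.fderiv_right (m := 1) (by norm_num)).differentiableAt (by norm_num)
  obtain ⟨hf, hf'⟩ := hasFDerivAt_frame_apply (hasFDerivAt_const w q) X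
  have h1 := fderiv_inner_apply ℝ hG (differentiableAt_const w) X
  have h2 : (fun x => inner ℝ (hgrad U x) w) = fun x => fderiv ℝ U x (frame x w) :=
    funext fun x => inner_hgrad U x w
  rw [h2, fderiv_clm_apply hD hf] at h1
  simp at h1
  rw [← h1, hf']
  simp
  ring

/-- The derivative of the factor `‖hgrad U‖⁻¹` contributes a multiple of `hgrad U`, which `w` does
not see. -/
theorem inner_fderiv_unitGrad {U : Heis n → ℝ} {q : Heis n} (hU : ContDiffAt ℝ 2 U q)
    (h : hgrad U q ≠ 0) (X : Heis n) {w : Hor n} (hw : inner ℝ (hgrad U q) w = 0) :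
    inner ℝ (fderiv ℝ (unitGrad U) q X) w =
      ‖hgrad U q‖⁻¹ * inner ℝ (fderiv ℝ (hgrad U) q X) w := by
  have hG : DifferentiableAt ℝ (hgrad U) q :=
    (contDiffAt_hgrad (m := 1) hU (by norm_num)).differentiableAt (by norm_num)
  have hN : DifferentiableAt ℝ (fun x => ‖hgrad U x‖⁻¹) q :=
    (hG.norm ℝ h).inv (norm_ne_zero_iff.2 h)
  have : fderiv ℝ (unitGrad U) q = _ := fderiv_fun_smul hN hG
  rw [this]
  simp [inner_add_left, real_inner_smul_left, hw]

end Gradient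

/-! ### Defining functions adapted to the hypersurface and to the choice of `e_n`. -/

section Adapted

variable {n : ℕ} {M : Type*} [TopologicalSpace M]
  [ChartedSpace (EuclideanSpace ℝ (Fin (2 * n))) M]

theorem IsImmersedHypersurface.mdifferentiableAt {F : M → Heis n}
    (hF : IsImmersedHypersurface F) (p : M) :
    MDifferentiableAt (𝓡 (2 * n)) 𝓘(ℝ, Heis n) F p :=
  (hF.contMDiff p).mdifferentiableAt (by norm_num)

theorem IsImmersedHypersurface.continuous {F : M → Heis n}
    (hF : IsImmersedHypersurface F) : Continuous F := hF.contMDiff.continuous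

/-- A function vanishing on the hypersurface has vanishing tangential derivatives. -/
theorem fderiv_eq_zero_of_eventually {E : Type*} [NormedAddCommGroup E] [NormedSpace ℝ E]
    {F : M → Heis n} (hF : IsImmersedHypersurface F) {p : M} {Φ : Heis n → E}
    (hΦ : DifferentiableAt ℝ Φ (F p)) (h : ∀ᶠ q in 𝓝 p, Φ (F q) = 0) {X : Heis n}
    (hX : X ∈ tangentPlane F p) : fderiv ℝ Φ (F p) X = 0 := by
  obtain ⟨x, rfl⟩ := hX
  have h1 : HasMFDerivAt (𝓡 (2 * n)) 𝓘(ℝ, E) (Φ ∘ F) p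
      ((fderiv ℝ Φ (F p)).comp (differential F p)) :=
    HasMFDerivAt.comp p hΦ.hasFDerivAt.hasMFDerivAt (hF.mdifferentiableAt p).hasMFDerivAt
  have h2 : HasMFDerivAt (𝓡 (2 * n)) 𝓘(ℝ, E) (Φ ∘ F) p
      (0 : TangentSpace (𝓡 (2 * n)) p →L[ℝ] E) :=
    (hasMFDerivAt_const (0 : E) p).congr_of_eventuallyEq h
  exact congrArg (fun L => L x) (hasMFDerivAt_unique h1 h2)

theorem finrank_tangentPlane {F : M → Heis n} (hF : IsImmersedHypersurface F) (p : M) :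
    Module.finrank ℝ (tangentPlane F p) = 2 * n := by
  rw [tangentPlane, LinearMap.finrank_range_of_inj (hF.injective_differential p)]
  exact finrank_euclideanSpace_fin

/-- One inclusion holds because `U` vanishes along the hypersurface; both spaces have dimension
`2n`. -/
theorem tangentPlane_eq_ker {F : M → Heis n} (hF : IsImmersedHypersurface F) {p : M}
    {U : Heis n → ℝ} (hU : DifferentiableAt ℝ U (F p)) (hne : fderiv ℝ U (F p) ≠ 0)
    (h0 : ∀ᶠ q in 𝓝 p, U (F q) = 0) :
    tangentPlane F p = LinearMap.ker (fderiv ℝ U (F p)).toLinearMap := by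
  refine Submodule.eq_of_le_of_finrank_eq
    (fun X hX => fderiv_eq_zero_of_eventually hF hU h0 hX) ?_
  have h := Module.Dual.finrank_ker_add_one_of_ne_zero (K := ℝ) (V₁ := Heis n)
    (f := (fderiv ℝ U (F p)).toLinearMap) 
    (fun h => hne (ContinuousLinearMap.ext fun x => congrArg (fun L => L x) h))
  rw [finrank_Heis] at h
  rw [finrank_tangentPlane hF]
  omega

/-- `U` is, near `p`, a `C²` defining function of the hypersurface whose unit horizontal
gradient is the horizontal normal `e_{2n}`. -/
structure IsAdapted (F : M → Heis n) (e : M → Hor n) (U : Heis n → ℝ) (p : M) : Prop where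
  contDiffAt : ContDiffAt ℝ 2 U (F p)
  vanishing : ∀ᶠ q in 𝓝 p, U (F q) = 0
  hgrad_ne : hgrad U (F p) ≠ 0
  normal : ∀ᶠ q in 𝓝 p, horNormal e q = unitGrad U (F q)

theorem fderiv_ne_zero_of_hgrad_ne {U : Heis n → ℝ} {q : Heis n} (h : hgrad U q ≠ 0) :
    fderiv ℝ U q ≠ 0 := by
  intro h0
  apply h
  simp [hgrad, h0]

theorem continuousAt_hgrad {U : Heis n → ℝ} {q : Heis n} (hU : ContDiffAt ℝ 2 U q) :
    ContinuousAt (hgrad U) q :=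
  (contDiffAt_hgrad (m := 1) hU (by norm_num)).continuousAt

theorem IsAdapted.eventually {F : M → Heis n} {e : M → Hor n} {U : Heis n → ℝ} {p : M}
    (hF : IsImmersedHypersurface F) (h : IsAdapted F e U p) :
    ∀ᶠ q in 𝓝 p, IsAdapted F e U q := by
  have h1 : ∀ᶠ q in 𝓝 p, ContDiffAt ℝ 2 U (F q) :=
    hF.continuous.continuousAt.eventually (h.contDiffAt.eventually (by simp))
  have h2 : ∀ᶠ q in 𝓝 p, hgrad U (F q) ≠ 0 :=
    ((continuousAt_hgrad h.contDiffAt).comp hF.continuous.continuousAt).eventually_ne h.hgrad_ne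
  filter_upwards [h1, h2, h.vanishing.eventually_nhds, h.normal.eventually_nhds]
    with q a b c d using ⟨a, c, b, d⟩

theorem isRegular_of_hgrad_ne {F : M → Heis n} {p : M} {U : Heis n → ℝ}
    (hF : IsImmersedHypersurface F) (hU : ContDiffAt ℝ 2 U (F p))
    (h0 : ∀ᶠ q in 𝓝 p, U (F q) = 0) (hG : hgrad U (F p) ≠ 0) : IsRegular F p := by
  intro hs
  have ht := tangentPlane_eq_ker hF (hU.differentiableAt (by norm_num))
    (fderiv_ne_zero_of_hgrad_ne hG) h0
  apply hG
  refine ext_inner_right ℝ fun v => ?_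
  have : frame (F p) v ∈ tangentPlane F p := by
    rw [show tangentPlane F p = _ from hs]
    exact contactForm_frame _ _
  rw [ht] at this
  rw [inner_hgrad, inner_zero_left]
  exact this

/-- If the horizontal gradient vanished, `ker dU`, which is the tangent plane, would contain the
contact plane, and equal dimensions would make the point singular. -/
theorem hgrad_ne_of_isRegular {F : M → Heis n} {p : M} {U : Heis n → ℝ}
    (hF : IsImmersedHypersurface F) (hU : ContDiffAt ℝ 2 U (F p))
    (h0 : ∀ᶠ q in 𝓝 p, U (F q) = 0) (hne : fderiv ℝ U (F p) ≠ 0) (hp : IsRegular F p) :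
    hgrad U (F p) ≠ 0 := by
  intro hG
  have ht := tangentPlane_eq_ker hF (hU.differentiableAt (by norm_num)) hne h0
  apply hp
  refine (Submodule.eq_of_le_of_finrank_eq ?_ ?_).symm
  · rw [contactPlane_eq_range_frame, ht]
    rintro _ ⟨v, rfl⟩
    have := inner_hgrad U (F p) v
    rw [hG, inner_zero_left] at this
    exact this.symm
  · rw [finrank_contactPlane, finrank_tangentPlane hF]

theorem IsAdapted.isRegular {F : M → Heis n} {e : M → Hor n} {U : Heis n → ℝ} {p : M}
    (hF : IsImmersedHypersurface F) (h : IsAdapted F e U p) : IsRegular F p :=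
  isRegular_of_hgrad_ne hF h.contDiffAt h.vanishing h.hgrad_ne

theorem mem_horTangent_iff {F : M → Heis n} {p : M} {U : Heis n → ℝ}
    (hF : IsImmersedHypersurface F) (hU : ContDiffAt ℝ 2 U (F p))
    (h0 : ∀ᶠ q in 𝓝 p, U (F q) = 0) (hG : hgrad U (F p) ≠ 0) {v : Hor n} :
    v ∈ horTangent F p ↔ inner ℝ (hgrad U (F p)) v = 0 := by
  rw [horTangent, tangentPlane_eq_ker hF (hU.differentiableAt (by norm_num))
    (fderiv_ne_zero_of_hgrad_ne hG) h0, inner_hgrad]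
  rfl

theorem mem_xiPrime_iff {F : M → Heis n} {p : M} {U : Heis n → ℝ}
    (hF : IsImmersedHypersurface F) (hU : ContDiffAt ℝ 2 U (F p))
    (h0 : ∀ᶠ q in 𝓝 p, U (F q) = 0) (hG : hgrad U (F p) ≠ 0) {v : Hor n} :
    v ∈ xiPrime F p ↔
      inner ℝ (hgrad U (F p)) v = 0 ∧ inner ℝ (J n (hgrad U (F p))) v = 0 := by
  have key : ∀ w, w ∈ horTangent F p ↔ _ := fun w => mem_horTangent_iff hF hU h0 hG
  rw [xiPrime, Submodule.mem_inf, key]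
  refine and_congr_right fun _ => ⟨?_, fun h => ⟨-J n v, ?_, ?_⟩⟩
  · rintro ⟨w, hw, rfl⟩
    rw [inner_J_J]
    exact (key w).1 hw
  · refine (key _).2 ?_
    rw [inner_neg_right, ← inner_J_left, h]
  · rw [map_neg, J_J, neg_neg]

/-- The characteristic field is, up to sign, `J` of the unit horizontal gradient. -/
theorem IsCharacteristicField.eq_or_eq {F : M → Heis n} {e : M → Hor n} {p : M}
    {U : Heis n → ℝ} (he : IsCharacteristicField F e)
    (hF : IsImmersedHypersurface F) (hU : ContDiffAt ℝ 2 U (F p))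
    (h0 : ∀ᶠ q in 𝓝 p, U (F q) = 0) (hG : hgrad U (F p) ≠ 0) :
    horNormal e p = unitGrad U (F p) ∨ horNormal e p = -unitGrad U (F p) := by
  have hp := isRegular_of_hgrad_ne hF hU h0 hG
  set N := unitGrad U (F p) with hN
  have hGN : hgrad U (F p) = ‖hgrad U (F p)‖ • N := hgrad_eq_norm_smul U (F p)
  have hG' : ‖hgrad U (F p)‖ ≠ 0 := norm_ne_zero_iff.2 hG
  have hN1 : ‖N‖ = 1 := norm_unitGrad hG
  have hN2 : inner ℝ N N = 1 := by rw [real_inner_self_eq_norm_sq, hN1, one_pow]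
  have he1 : inner ℝ N (e p) = 0 := by
    have := (mem_horTangent_iff hF hU h0 hG).1 (he.mem_horTangent p hp)
    rw [hGN, real_inner_smul_left] at this
    exact (mul_eq_zero.1 this).resolve_left hG'
  set a := inner ℝ (J n N) (e p) with ha
  -- The difference lies in `ξ'`, while both `e p` and `J N` are perpendicular to `ξ'`; so it is
  -- orthogonal to itself.
  have hx : e p - a • J n N ∈ xiPrime F p := by
    rw [mem_xiPrime_iff hF hU h0 hG, hGN, map_smul, real_inner_smul_left, real_inner_smul_left]
    constructor
    · rw [inner_sub_right, he1, inner_smul_right, inner_J_self]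
      simp
    · rw [inner_sub_right, inner_smul_right, inner_J_J, hN2, ← ha]
      simp
  have hperp : inner ℝ (e p - a • J n N) (e p) = 0 := he.mem_orthogonal p hp _ hx
  have hperp2 : inner ℝ (e p - a • J n N) (J n N) = 0 := by
    rw [real_inner_comm, inner_sub_right, inner_smul_right, inner_J_J, hN2, ← ha]
    simp
  have hz : e p - a • J n N = 0 := by
    rw [← inner_self_eq_zero (𝕜 := ℝ), inner_sub_right, inner_smul_right, hperp, hperp2]
    simp
  have hea : e p = a • J n N := sub_eq_zero.1 hz
  have ha1 : |a| = 1 := by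
    have := he.norm_eq_one p hp
    rwa [hea, norm_smul, norm_J, hN1, mul_one, Real.norm_eq_abs] at this
  have hJe : horNormal e p = -(a • N) := by
    rw [horNormal, hea, map_smul, J_J, smul_neg]
  rw [hJe]
  rcases (abs_eq zero_le_one).1 ha1 with h | h <;> simp [h]

/-- Pointwise `e_{2n}` is plus or minus the unit gradient. Their inner product is continuous with
values `1` and `-1`, so the sign is locally constant and can be absorbed into `U`. -/
theorem exists_isAdapted {F : M → Heis n} {e : M → Hor n} {p : M}
    {U : Heis n → ℝ} (he : IsCharacteristicField F e)
    (hF : IsImmersedHypersurface F) (hU : ContDiffAt ℝ 2 U (F p))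
    (h0 : ∀ᶠ q in 𝓝 p, U (F q) = 0) (hG : hgrad U (F p) ≠ 0) :
    IsAdapted F e U p ∨ IsAdapted F e (fun x => -U x) p := by
  have h1 : ∀ᶠ q in 𝓝 p, ContDiffAt ℝ 2 U (F q) :=
    hF.continuous.continuousAt.eventually (hU.eventually (by simp))
  have h2 : ∀ᶠ q in 𝓝 p, hgrad U (F q) ≠ 0 :=
    ((continuousAt_hgrad hU).comp hF.continuous.continuousAt).eventually_ne hG
  have h3 : ∀ᶠ q in 𝓝 p, horNormal e q = unitGrad U (F q) ∨
      horNormal e q = -unitGrad U (F q) := by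
    filter_upwards [h1, h2, h0.eventually_nhds] with q a b c using he.eq_or_eq hF a c b
  have h4 : ∀ᶠ q in 𝓝 p, IsRegular F q := by
    filter_upwards [h1, h2, h0.eventually_nhds] with q a b c using
      isRegular_of_hgrad_ne hF a c b
  have hec : ContinuousAt e p := he.continuousOn.continuousAt h4
  have hNc : ContinuousAt (fun q => unitGrad U (F q)) p :=
    ContinuousAt.comp (g := unitGrad U)
      (contDiffAt_unitGrad (m := 1) hU (by norm_num) hG).continuousAt hF.continuous.continuousAt
  have hc : ContinuousAt (fun q => inner ℝ (horNormal e q) (unitGrad U (F q))) p :=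
    ContinuousAt.inner ((JL n).continuous.continuousAt.comp hec) hNc
  have h5 : ∀ᶠ q in 𝓝 p, inner ℝ (unitGrad U (F q)) (unitGrad U (F q)) = (1 : ℝ) := by
    filter_upwards [h2] with q hq
    rw [real_inner_self_eq_norm_sq, norm_unitGrad hq, one_pow]
  rcases h3.self_of_nhds with h | h
  · left
    refine ⟨hU, h0, hG, ?_⟩
    have hpos : (0 : ℝ) < inner ℝ (horNormal e p) (unitGrad U (F p)) := by
      rw [h, h5.self_of_nhds]; norm_num
    have h6 := hc.eventually (lt_mem_nhds hpos)
    filter_upwards [h3, h5, h6] with q a b d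
    rcases a with a | a
    · exact a
    · rw [a, inner_neg_left, b] at d
      norm_num at d
  · right
    refine ⟨hU.neg, by simpa using h0, by simpa [hgrad_neg] using hG, ?_⟩
    have hneg : inner ℝ (horNormal e p) (unitGrad U (F p)) < (0 : ℝ) := by
      rw [h, inner_neg_left, h5.self_of_nhds]; norm_num
    have h6 := hc.eventually (gt_mem_nhds hneg)
    filter_upwards [h3, h5, h6] with q a b d
    rcases a with a | a
    · rw [a, b] at d
      norm_num at d
    · rw [a, unitGrad, unitGrad, hgrad_neg, norm_neg, smul_neg]

/-- At a regular point there is a `C^∞` adapted defining function. -/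
theorem exists_smooth_isAdapted {F : M → Heis n} {e : M → Hor n} {p : M}
    (he : IsCharacteristicField F e) (hF : IsImmersedHypersurface F) (hp : IsRegular F p) :
    ∃ U : Heis n → ℝ, ContDiff ℝ ∞ U ∧ IsAdapted F e U p := by
  obtain ⟨u, hu, hne, h0⟩ := hF.smooth_regular p hp
  have hu2 : ContDiffAt ℝ 2 u (F p) := hu.contDiffAt.of_le ENat.LEInfty.out
  rcases exists_isAdapted he hF hu2 h0 (hgrad_ne_of_isRegular hF hu2 h0 hne hp) with h | h
  · exact ⟨u, hu, h⟩
  · exact ⟨_, hu.neg, h⟩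

end Adapted

/-- A symmetric operator with at most one eigenvalue on a nontrivial space is scalar. -/
theorem exists_eq_smul_of_isSymmetric {V : Type*} [NormedAddCommGroup V]
    [InnerProductSpace ℝ V] [FiniteDimensional ℝ V] [Nontrivial V] {A : V →ₗ[ℝ] V}
    (hA : A.IsSymmetric)
    (huniq : ∀ k k' : ℝ, (∃ v, v ≠ 0 ∧ A v = k • v) → (∃ v, v ≠ 0 ∧ A v = k' • v) → k = k') :
    ∃ k : ℝ, ∀ v, A v = k • v := by
  have hpos : 0 < Module.finrank ℝ V := Module.finrank_pos
  let b := hA.eigenvectorBasis rfl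
  have hb : ∀ i, A (b i) = hA.eigenvalues rfl i • b i := fun i =>
    hA.apply_eigenvectorBasis rfl i
  have hne : ∀ i, b i ≠ 0 := fun i => b.orthonormal.ne_zero i
  refine ⟨hA.eigenvalues rfl ⟨0, hpos⟩, fun v => ?_⟩
  conv_lhs => rw [← b.sum_repr v]
  conv_rhs => rw [← b.sum_repr v]
  rw [map_sum, Finset.smul_sum]
  refine Finset.sum_congr rfl fun i _ => ?_
  rw [map_smul, hb, huniq _ _ ⟨b i, hne i, hb i⟩ ⟨b _, hne _, hb ⟨0, hpos⟩⟩, smul_comm]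

/-! ### The normal form of the derivative of the horizontal normal at an umbilic point. -/

section Normal

set_option linter.unusedSectionVars false

variable {n : ℕ} {M : Type*} [TopologicalSpace M]
  [ChartedSpace (EuclideanSpace ℝ (Fin (2 * n))) M]
  {F : M → Heis n} {e : M → Hor n} {U : Heis n → ℝ} {p : M}

namespace IsAdapted

theorem horNormal_eq (h : IsAdapted F e U p) : horNormal e p = unitGrad U (F p) :=
  h.normal.self_of_nhds

theorem field_eq (h : IsAdapted F e U p) : e p = -J n (unitGrad U (F p)) := by
  rw [← h.horNormal_eq, horNormal, J_J, neg_neg]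

theorem norm_pos (h : IsAdapted F e U p) : 0 < ‖hgrad U (F p)‖ := norm_pos_iff.2 h.hgrad_ne

theorem norm_horNormal (h : IsAdapted F e U p) : ‖horNormal e p‖ = 1 := by
  rw [h.horNormal_eq, norm_unitGrad h.hgrad_ne]

theorem norm_field (h : IsAdapted F e U p) : ‖e p‖ = 1 := by
  rw [← norm_J, ← h.norm_horNormal, horNormal]

theorem inner_hgrad_eq (h : IsAdapted F e U p) (v : Hor n) :
    inner ℝ (hgrad U (F p)) v = ‖hgrad U (F p)‖ * inner ℝ (horNormal e p) v := by
  rw [h.horNormal_eq, ← real_inner_smul_left, ← hgrad_eq_norm_smul]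

theorem mem_horTangent (hF : IsImmersedHypersurface F) (h : IsAdapted F e U p) {v : Hor n} :
    v ∈ horTangent F p ↔ inner ℝ (horNormal e p) v = 0 := by
  rw [mem_horTangent_iff hF h.contDiffAt h.vanishing h.hgrad_ne, h.inner_hgrad_eq]
  simp [h.hgrad_ne]

theorem mem_xiPrime (hF : IsImmersedHypersurface F) (h : IsAdapted F e U p) {v : Hor n} :
    v ∈ xiPrime F p ↔ inner ℝ (horNormal e p) v = 0 ∧ inner ℝ (e p) v = 0 := by
  rw [mem_xiPrime_iff hF h.contDiffAt h.vanishing h.hgrad_ne, inner_J_left, h.inner_hgrad_eq,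
    h.inner_hgrad_eq, horNormal, inner_J_J]
  simp [h.hgrad_ne]

theorem field_mem (hF : IsImmersedHypersurface F) (h : IsAdapted F e U p) :
    e p ∈ horTangent F p := by
  rw [h.mem_horTangent hF, horNormal, inner_J_self']

theorem J_mem_xiPrime (hF : IsImmersedHypersurface F) (h : IsAdapted F e U p) {v : Hor n}
    (hv : v ∈ xiPrime F p) : J n v ∈ xiPrime F p := by
  rw [h.mem_xiPrime hF] at *
  rw [horNormal, inner_J_J, hv.2, inner_J_right, ← horNormal, hv.1]
  simp

theorem exists_mem_xiPrime (hn : 2 ≤ n) (hF : IsImmersedHypersurface F)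
    (h : IsAdapted F e U p) : ∃ v ∈ xiPrime F p, v ≠ 0 := by
  obtain ⟨v, h0, h1, h2⟩ := exists_ne_zero_orthogonal hn (e p)
  exact ⟨v, (h.mem_xiPrime hF).2 ⟨h2, h1⟩, h0⟩

theorem tangentPlane_eq (hF : IsImmersedHypersurface F) (h : IsAdapted F e U p) :
    tangentPlane F p = LinearMap.ker (fderiv ℝ U (F p)).toLinearMap :=
  tangentPlane_eq_ker hF (h.contDiffAt.differentiableAt (by norm_num))
    (fderiv_ne_zero_of_hgrad_ne h.hgrad_ne) h.vanishing

theorem fderiv_horNormal (h : IsAdapted F e U p) :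
    fderiv ℝ U (F p) (frame (F p) (horNormal e p)) = ‖hgrad U (F p)‖ := by
  rw [← inner_hgrad, h.inner_hgrad_eq, real_inner_self_eq_norm_sq, h.norm_horNormal]
  simp

/-- The condition `dU (a e_{2n} + T) = 0` is affine in `a` with slope `‖hgrad U‖ ≠ 0`, so the choice
in `alpha` has exactly one candidate. -/
theorem alpha_eq (hF : IsImmersedHypersurface F) (h : IsAdapted F e U p) :
    alpha F e p = -(‖hgrad U (F p)‖⁻¹ * fderiv ℝ U (F p) (reeb n)) := by
  have key : ∀ a : ℝ, a • frame (F p) (horNormal e p) + reeb n ∈ tangentPlane F p ↔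
      a * ‖hgrad U (F p)‖ + fderiv ℝ U (F p) (reeb n) = 0 := by
    intro a
    rw [h.tangentPlane_eq hF, LinearMap.mem_ker]
    simp [h.fderiv_horNormal]
  have hne := h.norm_pos.ne'
  have := Classical.epsilon_spec (p := fun a : ℝ =>
    a • frame (F p) (horNormal e p) + reeb n ∈ tangentPlane F p)
    ⟨-(‖hgrad U (F p)‖⁻¹ * fderiv ℝ U (F p) (reeb n)), by rw [key]; field_simp; ring⟩
  rw [key] at this
  rw [alpha]
  field_simp
  linarith

theorem differentiableAt_unitGrad (h : IsAdapted F e U p) :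
    DifferentiableAt ℝ (unitGrad U) (F p) :=
  (contDiffAt_unitGrad (m := 1) h.contDiffAt (by norm_num) h.hgrad_ne).differentiableAt
    (by norm_num)

/-- Along the hypersurface `e_{2n}` is the restriction of an ambient field, so the chain rule
replaces the manifold derivative by an ordinary one. -/
theorem covDeriv_eq (hF : IsImmersedHypersurface F) (h : IsAdapted F e U p) {v : Hor n}
    (hv : v ∈ horTangent F p) :
    covDeriv F (horNormal e) p v = fderiv ℝ (unitGrad U) (F p) (frame (F p) v) := by
  have h1 : HasMFDerivAt (𝓡 (2 * n)) 𝓘(ℝ, Hor n) (unitGrad U ∘ F) p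
      ((fderiv ℝ (unitGrad U) (F p)).comp (differential F p)) :=
    HasMFDerivAt.comp p h.differentiableAt_unitGrad.hasFDerivAt.hasMFDerivAt
      (hF.mdifferentiableAt p).hasMFDerivAt
  have h2 := h1.congr_of_eventuallyEq h.normal
  have h3 : differential F p (Function.invFun (differential F p) (frame (F p) v)) =
      frame (F p) v := Function.invFun_eq hv
  rw [covDeriv, h2.mfderiv]
  exact congrArg (fderiv ℝ (unitGrad U) (F p)) h3

/-- The Hessian of `U` is symmetric. The asymmetry comes only from the noncommuting frame, which
adds a multiple of `dU(T)`; after division by `‖hgrad U‖` this is a multiple of `α`. -/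
theorem inner_fderiv_sub (hF : IsImmersedHypersurface F) (h : IsAdapted F e U p) {v w : Hor n}
    (hv : v ∈ horTangent F p) (hw : w ∈ horTangent F p) :
    inner ℝ (fderiv ℝ (unitGrad U) (F p) (frame (F p) v)) w -
      inner ℝ v (fderiv ℝ (unitGrad U) (F p) (frame (F p) w)) =
      2 * alpha F e p * inner ℝ (J n v) w := by
  rw [mem_horTangent_iff hF h.contDiffAt h.vanishing h.hgrad_ne] at hv hw
  rw [real_inner_comm _ v, inner_fderiv_unitGrad h.contDiffAt h.hgrad_ne _ hw,
    inner_fderiv_unitGrad h.contDiffAt h.hgrad_ne _ hv, inner_fderiv_hgrad h.contDiffAt,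
    inner_fderiv_hgrad h.contDiffAt, h.alpha_eq hF]
  have hs : IsSymmSndFDerivAt ℝ U (F p) := h.contDiffAt.isSymmSndFDerivAt (by simp)
  rw [hs.eq]
  simp only [frame_apply]
  rw [inner_J_right v w, real_inner_comm (J n v) w]
  ring

/-- Differentiate the constant length of the unit normal along the hypersurface. -/
theorem inner_horNormal_fderiv (h : IsAdapted F e U p) (hF : IsImmersedHypersurface F)
    (X : Heis n) (hX : X ∈ tangentPlane F p) :
    inner ℝ (horNormal e p) (fderiv ℝ (unitGrad U) (F p) X) = 0 := by
  have hd := h.differentiableAt_unitGrad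
  have h1 : ∀ᶠ q in 𝓝 p, inner ℝ (unitGrad U (F q)) (unitGrad U (F q)) - (1 : ℝ) = 0 := by
    filter_upwards [h.eventually hF] with q hq
    rw [real_inner_self_eq_norm_sq, norm_unitGrad hq.hgrad_ne]
    norm_num
  have h2 := fderiv_eq_zero_of_eventually (Φ := fun x => inner ℝ (unitGrad U x)
    (unitGrad U x) - (1 : ℝ)) hF ((hd.inner ℝ hd).sub_const 1) h1 hX
  rw [fderiv_sub_const, fderiv_inner_apply ℝ hd hd, real_inner_comm] at h2
  rw [h.horNormal_eq, real_inner_comm]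
  linarith

theorem eq_smul_field_add (hF : IsImmersedHypersurface F) (h : IsAdapted F e U p) {v : Hor n}
    (hv : v ∈ horTangent F p) : v - inner ℝ (e p) v • e p ∈ xiPrime F p := by
  rw [h.mem_xiPrime hF, inner_sub_right, inner_sub_right, inner_smul_right, inner_smul_right,
    (h.mem_horTangent hF).1 hv, (h.mem_horTangent hF).1 (h.field_mem hF),
    real_inner_self_eq_norm_sq, h.norm_field]
  simp

theorem finrank_horTangent (hF : IsImmersedHypersurface F) (h : IsAdapted F e U p) :
    Module.finrank ℝ (horTangent F p) + 1 = 2 * n := by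
  have hne : (innerSL ℝ (horNormal e p)).toLinearMap ≠ 0 := by
    intro h0
    have : inner ℝ (horNormal e p) (horNormal e p) = (0 : ℝ) :=
      congrArg (fun L => L (horNormal e p)) h0
    rw [real_inner_self_eq_norm_sq, h.norm_horNormal] at this
    norm_num at this
  have hk := Module.Dual.finrank_ker_add_one_of_ne_zero (K := ℝ) (V₁ := Hor n) hne
  have : horTangent F p = LinearMap.ker (innerSL ℝ (horNormal e p)).toLinearMap := by
    ext v
    rw [h.mem_horTangent hF]
    rfl
  rw [this, hk, finrank_Hor]

/-- At an umbilic point the derivative of the horizontal normal is determined by `k`, `l` and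
`α`, and the `p`-mean curvature is `l + (2n - 2) k`. -/
theorem exists_normal_form (hn : 2 ≤ n) (hF : IsImmersedHypersurface F)
    (h : IsAdapted F e U p) (humb : IsUmbilicPoint F e p) :
    ∃ k : ℝ, IsEigenvalue F e p k ∧
      (∀ v ∈ xiPrime F p, fderiv ℝ (unitGrad U) (F p) (frame (F p) v) =
        -(k • v) + alpha F e p • J n v) ∧
      fderiv ℝ (unitGrad U) (F p) (frame (F p) (e p)) = -(ell F e p • e p) ∧
      pMeanCurvature F e p = ell F e p + (2 * n - 2) * k := by
  set D : Hor n →ₗ[ℝ] Hor n :=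
    (fderiv ℝ (unitGrad U) (F p)).toLinearMap ∘ₗ frame (F p) with hD
  have hDv : ∀ v, fderiv ℝ (unitGrad U) (F p) (frame (F p) v) = D v := fun v => rfl
  set α := alpha F e p with hα
  let A₀ : Hor n →ₗ[ℝ] Hor n := -D + α • J n
  have hxi : ∀ v ∈ xiPrime F p, v ∈ horTangent F p := fun v hv => hv.1
  have hshape : ∀ v ∈ xiPrime F p, shapeOp F e p v = A₀ v := by
    intro v hv
    rw [shapeOp, h.covDeriv_eq hF (hxi v hv), JPrime, ((h.mem_xiPrime hF).1 hv).2]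
    simp [A₀, hD, hα]
  have hinv : ∀ v ∈ xiPrime F p, A₀ v ∈ xiPrime F p := fun v hv =>
    hshape v hv ▸ humb.invariant v hv
  let A : xiPrime F p →ₗ[ℝ] xiPrime F p := A₀.restrict hinv
  have hsub : ∀ v ∈ horTangent F p, ∀ w ∈ horTangent F p,
      inner ℝ (D v) w - inner ℝ v (D w) = 2 * α * inner ℝ (J n v) w :=
    fun v hv w hw => h.inner_fderiv_sub hF hv hw
  -- Adding `α J` cancels exactly the skew part of `-D` given by `inner_fderiv_sub`.
  have hA : A.IsSymmetric := by
    rintro ⟨v, hv⟩ ⟨w, hw⟩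
    have := hsub v (hxi v hv) w (hxi w hw)
    change inner ℝ (A₀ v) w = inner ℝ v (A₀ w)
    simp only [A₀, LinearMap.add_apply, LinearMap.neg_apply, LinearMap.smul_apply,
      inner_add_left, inner_add_right, inner_neg_left, inner_neg_right, inner_smul_right,
      real_inner_smul_left]
    rw [inner_J_right v w]
    linarith
  obtain ⟨v₀, hv₀, hv₀ne⟩ := h.exists_mem_xiPrime hn hF
  have : Nontrivial (xiPrime F p) :=
    ⟨⟨⟨v₀, hv₀⟩, 0, fun hh => hv₀ne (congrArg Subtype.val hh)⟩⟩
  have heig : ∀ k : ℝ, (∃ v, v ≠ 0 ∧ A v = k • v) → IsEigenvalue F e p k := by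
    rintro k ⟨⟨v, hv⟩, hne, hk⟩
    refine ⟨v, hv, fun h0 => hne (Subtype.ext h0), ?_⟩
    rw [hshape v hv]
    exact congrArg Subtype.val hk
  obtain ⟨k, hk⟩ := exists_eq_smul_of_isSymmetric hA fun k k' a b =>
    humb.eigenvalue_unique k k' (heig k a) (heig k' b)
  have hkeig : IsEigenvalue F e p k :=
    heig k ⟨⟨v₀, hv₀⟩, fun hh => hv₀ne (congrArg Subtype.val hh), hk _⟩
  have hDxi : ∀ v ∈ xiPrime F p, D v = -(k • v) + α • J n v := by
    intro v hv
    have h1 : A₀ v = k • v := congrArg Subtype.val (hk ⟨v, hv⟩)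
    have h2 : A₀ v = -D v + α • J n v := rfl
    rw [← h1, h2]
    abel
  have hee : inner ℝ (e p) (e p) = (1 : ℝ) := by
    rw [real_inner_self_eq_norm_sq, h.norm_field, one_pow]
  have hemem := h.field_mem hF
  have hell : ell F e p = -inner ℝ (D (e p)) (e p) := by
    rw [ell, h.covDeriv_eq hF hemem, inner_neg_left, hDv]
  have hDe : D (e p) = -(ell F e p • e p) := by
    have ht : D (e p) ∈ horTangent F p := by
      rw [h.mem_horTangent hF]
      exact h.inner_horNormal_fderiv hF _ hemem
    have hx := h.eq_smul_field_add hF ht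
    set w := D (e p) - inner ℝ (e p) (D (e p)) • e p with hw
    -- The `ξ'`-part `w` of `D e_n` vanishes: `D` maps `ξ'` into itself, so `⟨e_n, D w⟩ = 0`, and
    -- `⟨J e_n, w⟩ = 0`, whence `⟨D e_n, w⟩ = 0`.
    have h1 := hsub _ hemem w (hxi w hx)
    rw [hDxi w hx, inner_add_right, inner_neg_right, inner_smul_right, inner_smul_right,
      ((h.mem_xiPrime hF).1 hx).2, ((h.mem_xiPrime hF).1 (h.J_mem_xiPrime hF hx)).2,
      ← horNormal, ((h.mem_xiPrime hF).1 hx).1] at h1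
    have h2 : inner ℝ w w = (0 : ℝ) := by
      conv_lhs => enter [2]; rw [hw]
      rw [inner_sub_left, real_inner_smul_left, ((h.mem_xiPrime hF).1 hx).2]
      linarith
    rw [inner_self_eq_zero] at h2
    rw [h2] at hw
    rw [hell, neg_smul, neg_neg, real_inner_comm]
    exact (sub_eq_zero.1 hw.symm)
  refine ⟨k, hkeig, hDxi, hDe, ?_⟩
  -- With this quadratic form, the trace over any orthonormal basis needs only the dimension `2n -
  -- 1` and Parseval for the unit vector `e_n`.
  have hterm : ∀ v ∈ horTangent F p, inner ℝ (-covDeriv F (horNormal e) p v) v =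
      k * ‖v‖ ^ 2 + (ell F e p - k) * inner ℝ (e p) v ^ 2 := by
    intro v hv
    rw [h.covDeriv_eq hF hv, hDv]
    have hx := h.eq_smul_field_add hF hv
    set a := inner ℝ (e p) v with ha
    set w := v - a • e p with hw
    have hvw : v = w + a • e p := by rw [hw]; abel
    have hew := ((h.mem_xiPrime hF).1 hx).2
    have hJew : inner ℝ (J n w) (e p) = (0 : ℝ) := by
      rw [real_inner_comm]; exact ((h.mem_xiPrime hF).1 (h.J_mem_xiPrime hF hx)).2
    have hwe : inner ℝ w (e p) = (0 : ℝ) := by rw [real_inner_comm]; exact hew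
    rw [← real_inner_self_eq_norm_sq, hvw, map_add, map_smul, hDxi w hx, hDe]
    simp only [inner_add_left, inner_add_right, inner_neg_left, inner_smul_right,
      real_inner_smul_left, smul_neg, neg_add, hew, hwe, hJew, hee, inner_J_self']
    ring
  have hsum : ∑ a, inner ℝ (e p) (stdOrthonormalBasis ℝ (horTangent F p) a : Hor n) ^ 2 =
      (1 : ℝ) := by
    have := (stdOrthonormalBasis ℝ (horTangent F p)).sum_sq_norm_inner_left ⟨e p, hemem⟩
    rw [show ‖(⟨e p, hemem⟩ : horTangent F p)‖ = 1 from h.norm_field] at this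
    simpa using this
  rw [pMeanCurvature, Finset.sum_congr rfl fun a _ => hterm _ (Subtype.coe_prop _),
    Finset.sum_add_distrib, ← Finset.mul_sum, ← Finset.mul_sum, hsum]
  have hone : ∀ a, ‖(stdOrthonormalBasis ℝ (horTangent F p) a : Hor n)‖ = 1 := fun a =>
    (stdOrthonormalBasis ℝ (horTangent F p)).orthonormal.1 a
  have hfin : (Module.finrank ℝ (horTangent F p) : ℝ) + 1 = 2 * n := by
    exact_mod_cast h.finrank_horTangent hF
  simp only [hone, one_pow, Finset.sum_const, Finset.card_univ, Fintype.card_fin, nsmul_eq_mul,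
    mul_one]
  rw [show (2 * n - 2 : ℝ) = Module.finrank ℝ (horTangent F p) - 1 by linarith]
  ring

end IsAdapted

end Normal

/-! ### Ambient extensions of `e_n`, `l`, `α` and of vectors of `ξ'`. -/

section Ambient

variable {n : ℕ}

/-- The component of the fixed vector `v` orthogonal to `N` and `J N`. -/
def projField (N : Heis n → Hor n) (v : Hor n) (x : Heis n) : Hor n :=
  v - (inner ℝ v (N x) • N x + inner ℝ v (J n (N x)) • J n (N x))

theorem projField_eq {N : Heis n → Hor n} {v : Hor n} {q : Heis n}
    (h1 : inner ℝ v (N q) = 0) (h2 : inner ℝ v (J n (N q)) = 0) : projField N v q = v := by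
  simp [projField, h1, h2]

theorem contDiffAt_projField {N : Heis n → Hor n} {v : Hor n} {q : Heis n} {m : WithTop ℕ∞}
    (hN : ContDiffAt ℝ m N q) : ContDiffAt ℝ m (projField N v) q := by
  have hJ : ContDiffAt ℝ m (fun x => J n (N x)) q := (JL n).contDiff.contDiffAt.comp q hN
  exact contDiffAt_const.sub
    (((contDiffAt_const.inner ℝ hN).smul hN).add ((contDiffAt_const.inner ℝ hJ).smul hJ))

theorem hasFDerivAt_J_comp {N : Heis n → Hor n} {q : Heis n} (hN : DifferentiableAt ℝ N q) :
    HasFDerivAt (fun x => J n (N x)) ((JL n).comp (fderiv ℝ N q)) q :=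
  (JL n).hasFDerivAt.comp q hN.hasFDerivAt

/-- Since `v` is orthogonal to `N` and `J N` at `q`, only the derivatives of the two coefficients
survive. The result lies in the span of `N` and `J N`. -/
theorem fderiv_projField {N : Heis n → Hor n} {v : Hor n} {q : Heis n}
    (hN : DifferentiableAt ℝ N q) (h1 : inner ℝ v (N q) = 0) (h2 : inner ℝ v (J n (N q)) = 0)
    (X : Heis n) :
    fderiv ℝ (projField N v) q X =
      -(inner ℝ v (fderiv ℝ N q X) • N q + inner ℝ v (J n (fderiv ℝ N q X)) • J n (N q)) := by
  have hJ := hasFDerivAt_J_comp hN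
  have hd := hN.hasFDerivAt
  have hc := hasFDerivAt_const (𝕜 := ℝ) v q
  have : HasFDerivAt (projField N v) _ q :=
    hc.fun_sub (((hc.inner ℝ hd).fun_smul hd).fun_add ((hc.inner ℝ hJ).fun_smul hJ))
  rw [this.fderiv]
  simp [h1, h2]

variable (U : Heis n → ℝ)

/-- The extension of `e_n` by the level sets of `U`. -/
def charField (x : Heis n) : Hor n := -J n (unitGrad U x)

/-- The extension of `l` by the level sets of `U`. -/
def ambientEll (x : Heis n) : ℝ :=
  -inner ℝ (fderiv ℝ (unitGrad U) x (frame x (charField U x))) (charField U x)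

/-- The extension of `α` by the level sets of `U`. -/
def ambientAlpha (x : Heis n) : ℝ := -(‖hgrad U x‖⁻¹ * fderiv ℝ U x (reeb n))

variable {U}

theorem contDiffAt_charField {m k : WithTop ℕ∞} {q : Heis n}
    (hU : ContDiffAt ℝ k U q) (hmk : m + 1 ≤ k) (h : hgrad U q ≠ 0) :
    ContDiffAt ℝ m (charField U) q :=
  ((JL n).contDiff.contDiffAt.comp q (contDiffAt_unitGrad hU hmk h)).neg

/-- `C²` is what the commutation of second derivatives of `l` in `codazzi_vertical` requires; `l`
itself consumes two derivatives of `U`. -/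
theorem contDiffAt_ambientEll {q : Heis n} (hU : ContDiff ℝ ∞ U) (h : hgrad U q ≠ 0) :
    ContDiffAt ℝ 2 (ambientEll U) q := by
  have hN : ContDiffAt ℝ 3 (unitGrad U) q :=
    contDiffAt_unitGrad (k := 4) (hU.contDiffAt.of_le ENat.LEInfty.out) (by norm_num) h
  have hE : ContDiffAt ℝ 2 (charField U) q :=
    contDiffAt_charField (k := 4) (hU.contDiffAt.of_le ENat.LEInfty.out) (by norm_num) h
  exact (((hN.fderiv_right (m := 2) (by norm_num)).clm_apply
    (contDiff_frame_apply hE)).inner ℝ hE).neg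

theorem contDiffAt_ambientAlpha {q : Heis n} (hU : ContDiff ℝ ∞ U) (h : hgrad U q ≠ 0) :
    ContDiffAt ℝ 2 (ambientAlpha U) q := by
  have hG : ContDiffAt ℝ 2 (hgrad U) q :=
    contDiffAt_hgrad (k := 4) (hU.contDiffAt.of_le ENat.LEInfty.out) (by norm_num)
  have hU3 : ContDiffAt ℝ 3 U q := hU.contDiffAt.of_le ENat.LEInfty.out
  exact (((hG.norm ℝ h).inv (norm_ne_zero_iff.2 h)).mul
    ((hU3.fderiv_right (m := 2) (by norm_num)).clm_apply contDiffAt_const)).neg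

end Ambient

/-! ### Codazzi equations and the linear equation for `n l - c`. -/

section Codazzi

set_option linter.unusedSectionVars false

variable {n : ℕ} {M : Type*} [TopologicalSpace M]
  [ChartedSpace (EuclideanSpace ℝ (Fin (2 * n))) M]
  {F : M → Heis n} {e : M → Hor n} {U : Heis n → ℝ} {p : M}

namespace IsAdapted

theorem charField_eq (h : IsAdapted F e U p) : charField U (F p) = e p := h.field_eq.symm

theorem ambientAlpha_eq (hF : IsImmersedHypersurface F) (h : IsAdapted F e U p) :
    ambientAlpha U (F p) = alpha F e p := (h.alpha_eq hF).symm

theorem ambientEll_eq (hF : IsImmersedHypersurface F) (h : IsAdapted F e U p) :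
    ambientEll U (F p) = ell F e p := by
  rw [ell, h.covDeriv_eq hF (h.field_mem hF), ambientEll, h.charField_eq, inner_neg_left]

theorem projField_mem (hF : IsImmersedHypersurface F) (h : IsAdapted F e U p) (v : Hor n) :
    projField (unitGrad U) v (F p) ∈ xiPrime F p := by
  rw [h.mem_xiPrime hF, h.horNormal_eq, h.field_eq, projField]
  simp [inner_sub_right, inner_add_right, inner_smul_right, inner_J_self, inner_J_self',
    norm_J, norm_unitGrad h.hgrad_ne, real_inner_comm v]

theorem inner_eq_zero_of_mem (hF : IsImmersedHypersurface F) (h : IsAdapted F e U p)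
    {v : Hor n} (hv : v ∈ xiPrime F p) :
    inner ℝ v (unitGrad U (F p)) = 0 ∧ inner ℝ v (J n (unitGrad U (F p))) = 0 := by
  obtain ⟨h1, h2⟩ := (h.mem_xiPrime hF).1 hv
  rw [h.horNormal_eq] at h1
  rw [h.field_eq, inner_neg_left] at h2
  rw [real_inner_comm, h1, real_inner_comm]
  exact ⟨rfl, neg_eq_zero.1 h2⟩

end IsAdapted

/-- The Codazzi equations: on an umbilic hypersurface of constant `p`-mean curvature `c`,
`l` is constant along `ξ'`, and `e_n k = (l - 2 k) α`. -/
theorem codazzi (hn : 2 ≤ n) (hF : IsImmersedHypersurface F)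
    (humb : IsUmbilicHypersurface F e) {c : ℝ}
    (hH : ∀ p, IsRegular F p → pMeanCurvature F e p = c)
    (hU : ContDiff ℝ ∞ U) (h : IsAdapted F e U p) :
    (∀ v ∈ xiPrime F p, fderiv ℝ (ambientEll U) (F p) (frame (F p) v) = 0) ∧
    fderiv ℝ (ambientEll U) (F p) (frame (F p) (e p)) =
      -(2 * (n * ell F e p - c) * alpha F e p) := by
  have hn' : (2 : ℝ) ≤ n := by exact_mod_cast hn
  have hn0 : (2 * n - 2 : ℝ) ≠ 0 := by linarith
  set q := F p with hq
  set N := unitGrad U with hNdef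
  set kf : Heis n → ℝ := fun x => (c - ambientEll U x) / (2 * n - 2) with hkf
  -- The normal form holds at all nearby points, with `k` eliminated through `H = c`, so it may be
  -- differentiated along the hypersurface.
  have hform : ∀ᶠ p' in 𝓝 p, IsAdapted F e U p' ∧
      (∀ v ∈ xiPrime F p', fderiv ℝ N (F p') (frame (F p') v) =
        -(kf (F p') • v) + ambientAlpha U (F p') • J n v) ∧
      fderiv ℝ N (F p') (frame (F p') (charField U (F p'))) =
        -(ambientEll U (F p') • charField U (F p')) := by
    filter_upwards [h.eventually hF] with p' h'
    obtain ⟨k, -, h1, h2, h3⟩ := h'.exists_normal_form hn hF (humb p' (h'.isRegular hF))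
    rw [hH p' (h'.isRegular hF)] at h3
    have hk : kf (F p') = k := by
      rw [hkf]
      simp only [h'.ambientEll_eq hF]
      rw [div_eq_iff hn0]
      linarith
    rw [hk, h'.ambientAlpha_eq hF, h'.charField_eq, h'.ambientEll_eq hF]
    exact ⟨h', h1, h2⟩
  have hN3 : ContDiffAt ℝ 3 N q :=
    contDiffAt_unitGrad (k := 4) (hU.contDiffAt.of_le ENat.LEInfty.out) (by norm_num) h.hgrad_ne
  have hNd : DifferentiableAt ℝ N q := hN3.differentiableAt (by norm_num)
  have hDN : DifferentiableAt ℝ (fderiv ℝ N) q :=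
    (hN3.fderiv_right (m := 2) (by norm_num)).differentiableAt (by norm_num)
  have hsymm : IsSymmSndFDerivAt ℝ N q := hN3.isSymmSndFDerivAt (by simp; norm_num)
  have hl : DifferentiableAt ℝ (ambientEll U) q :=
    (contDiffAt_ambientEll hU h.hgrad_ne).differentiableAt (by norm_num)
  have ha : DifferentiableAt ℝ (ambientAlpha U) q :=
    (contDiffAt_ambientAlpha hU h.hgrad_ne).differentiableAt (by norm_num)
  have hk : HasFDerivAt kf ((2 * n - 2 : ℝ)⁻¹ • -fderiv ℝ (ambientEll U) q) q := by
    have := (hl.hasFDerivAt.const_sub c).const_mul (2 * n - 2 : ℝ)⁻¹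
    refine this.congr_of_eventuallyEq (Filter.Eventually.of_forall fun x => ?_)
    rw [hkf]
    exact div_eq_inv_mul _ _
  have hE : HasFDerivAt (charField U) (-((JL n).comp (fderiv ℝ N q))) q :=
    (hasFDerivAt_J_comp hNd).neg
  obtain ⟨-, hDξ, hDE⟩ := hform.self_of_nhds
  rw [h.charField_eq] at hDE
  simp only [← hq] at hDξ hDE
  set l := ambientEll U q with hldef
  set α := ambientAlpha U q with hαdef
  set k := kf q with hkdef
  have hEN : e p = -J n (N q) := h.field_eq
  have hJE : J n (e p) = N q := h.horNormal_eq
  have hee : inner ℝ (e p) (e p) = (1 : ℝ) := by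
    rw [real_inner_self_eq_norm_sq, h.norm_field, one_pow]
  -- The mixed second derivative of the horizontal normal in the directions `e_n` and `v`.
  have main : ∀ v ∈ xiPrime F p,
      (fderiv ℝ kf q (frame q (e p)) + 2 * k * α - l * α) • v +
      (-fderiv ℝ (ambientAlpha U) q (frame q (e p)) + k ^ 2 - α ^ 2 - l * k) • J n v =
      fderiv ℝ (ambientEll U) q (frame q v) • e p := by
    intro v hv
    obtain ⟨hv1, hv2⟩ := h.inner_eq_zero_of_mem hF hv
    have hve : inner ℝ v (e p) = (0 : ℝ) := by rw [hEN, inner_neg_right, hv2, neg_zero]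
    set V := projField N v with hV
    have hVq : V q = v := projField_eq hv1 hv2
    have hVd : HasFDerivAt V (fderiv ℝ V q) q :=
      ((contDiffAt_projField hN3).differentiableAt (by norm_num)).hasFDerivAt
    -- The derivative of `N` along `e_n` is `-l e_n`, and both `e_n` and `J e_n` are orthogonal to
    -- `v`.
    have hVE : fderiv ℝ V q (frame q (e p)) = 0 := by
      rw [hV, fderiv_projField hNd hv1 hv2, hDE, map_neg, map_smul, hJE, inner_neg_right,
        inner_neg_right, inner_smul_right, inner_smul_right, hve, hv1]
      simp
    have hCE : charField U q = e p := h.charField_eq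
    have hfst : ∀ w, (frame q w).1 = w := fun _ => rfl
    obtain ⟨hfV, hfV'⟩ := hasFDerivAt_frame_apply hVd (frame q (e p))
    obtain ⟨hfE, hfE'⟩ := hasFDerivAt_frame_apply hE (frame q v)
    have hJV := hasFDerivAt_J_comp hVd.differentiableAt
    -- `Φ` and `Ψ` are the two normal form equations, for `V` and for `e_n`. They vanish along the
    -- hypersurface, so `Φ` is differentiated along `e_n` and `Ψ` along `v`; each derivative
    -- contains one of the mixed second derivatives of `N`.
    have hΦ0 : HasFDerivAt (fun x => fderiv ℝ N x (frame x (V x)) + kf x • V x -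
        ambientAlpha U x • J n (V x)) _ q :=
      ((hDN.hasFDerivAt.clm_apply hfV.hasFDerivAt).fun_add
        (hk.differentiableAt.hasFDerivAt.fun_smul hVd)).fun_sub (ha.hasFDerivAt.fun_smul hJV)
    have hΨ0 : HasFDerivAt (fun x => fderiv ℝ N x (frame x (charField U x)) +
        ambientEll U x • charField U x) _ q :=
      (hDN.hasFDerivAt.clm_apply hfE.hasFDerivAt).fun_add (hl.hasFDerivAt.fun_smul hE)
    have hΦ := fderiv_eq_zero_of_eventually hF hΦ0.differentiableAt (by
      filter_upwards [hform] with p' hp'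
      rw [hp'.2.1 _ (hp'.1.projField_mem hF v)]
      abel) (h.field_mem hF)
    have hΨ := fderiv_eq_zero_of_eventually hF hΨ0.differentiableAt (by
      filter_upwards [hform] with p' hp'
      rw [hp'.2.2]
      simp) (show frame q v ∈ tangentPlane F p from hv.1)
    rw [hΦ0.fderiv] at hΦ
    rw [hΨ0.fderiv] at hΨ
    have hDEv : (-((JL n).comp (fderiv ℝ N q))) (frame q v) = k • J n v + α • v := by
      simp only [neg_apply, ContinuousLinearMap.comp_apply, JL_apply,
        hDξ v hv, map_add, map_neg, map_smul, J_J]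
      module
    have hJv := h.J_mem_xiPrime hF hv
    -- These two products are the coefficients of `T` produced by the moving frame; as they vanish,
    -- no `T`-derivative of `N` enters.
    have hB1 : inner ℝ (e p) (J n v) = (0 : ℝ) := ((h.mem_xiPrime hF).1 hJv).2
    have hB2 : inner ℝ v (J n (e p)) = (0 : ℝ) := by rw [hJE, hv1]
    rw [← hq] at hΦ
    simp only [add_apply, sub_apply, ContinuousLinearMap.comp_apply, smul_apply,
      ContinuousLinearMap.smulRight_apply, ContinuousLinearMap.flip_apply, hfV', hfE', hVE,
      hDEv, hVq, hCE, hfst, hB1, hB2, map_zero, zero_smul, smul_zero, zero_add,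
      add_zero] at hΦ hΨ
    rw [map_add (frame q), map_smul, map_smul, map_add, map_smul, map_smul, hDξ v hv,
      hDξ _ hJv, J_J, ← hldef] at hΨ
    have hs := hsymm.eq (frame q (e p)) (frame q v)
    linear_combination (norm := module) hΦ - hΨ - hs
  constructor
  · intro v hv
    have h1 := congrArg (fun w => inner ℝ w (e p)) (main v hv)
    have hve : inner ℝ v (e p) = (0 : ℝ) := by
      rw [real_inner_comm]; exact ((h.mem_xiPrime hF).1 hv).2
    have hJve : inner ℝ (J n v) (e p) = (0 : ℝ) := by
      rw [real_inner_comm]; exact ((h.mem_xiPrime hF).1 (h.J_mem_xiPrime hF hv)).2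
    simp only [inner_add_left, real_inner_smul_left, hve, hJve, hee] at h1
    linarith
  · obtain ⟨v, hv, hv0⟩ := h.exists_mem_xiPrime hn hF
    have h1 := congrArg (fun w => inner ℝ w v) (main v hv)
    simp only [inner_add_left, real_inner_smul_left, inner_J_self',
      ((h.mem_xiPrime hF).1 hv).2, mul_zero, add_zero] at h1
    have h2 := (mul_eq_zero.1 h1).resolve_right (inner_self_ne_zero.2 hv0)
    rw [hk.fderiv] at h2
    have hkl : (2 * n - 2) * k = c - l := mul_div_cancel₀ _ hn0
    simp only [smul_apply, neg_apply, smul_eq_mul] at h2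
    rw [← h.ambientEll_eq hF, ← h.ambientAlpha_eq hF]
    have h3 : (2 * n - 2 : ℝ) * (2 * n - 2 : ℝ)⁻¹ = 1 := mul_inv_cancel₀ hn0
    linear_combination -(2 * n - 2 : ℝ) * h2 + 2 * α * hkl -
      fderiv ℝ (ambientEll U) q (frame q (e p)) * h3

/-- The derivative of `l` in the direction `α e_{2n} + T`. -/
theorem codazzi_vertical (hn : 2 ≤ n) (hF : IsImmersedHypersurface F)
    (humb : IsUmbilicHypersurface F e) {c : ℝ}
    (hH : ∀ p, IsRegular F p → pMeanCurvature F e p = c)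
    (hU : ContDiff ℝ ∞ U) (h : IsAdapted F e U p) :
    fderiv ℝ (ambientEll U) (F p) (reeb n) +
      alpha F e p * fderiv ℝ (ambientEll U) (F p) (frame (F p) (horNormal e p)) +
      (c - ell F e p) / (2 * n - 2) *
        fderiv ℝ (ambientEll U) (F p) (frame (F p) (e p)) = 0 := by
  have hn' : (2 : ℝ) ≤ n := by exact_mod_cast hn
  have hn0 : (2 * n - 2 : ℝ) ≠ 0 := by linarith
  obtain ⟨k, -, hDξ, -, h3⟩ := h.exists_normal_form hn hF (humb p (h.isRegular hF))
  rw [hH p (h.isRegular hF)] at h3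
  have hk : (c - ell F e p) / (2 * n - 2) = k := by
    rw [div_eq_iff hn0]
    linarith
  rw [hk]
  set q := F p with hq
  set N := unitGrad U with hNdef
  set α := alpha F e p
  have hN3 : ContDiffAt ℝ 3 N q :=
    contDiffAt_unitGrad (k := 4) (hU.contDiffAt.of_le ENat.LEInfty.out) (by norm_num) h.hgrad_ne
  have hNd : DifferentiableAt ℝ N q := hN3.differentiableAt (by norm_num)
  have hl := contDiffAt_ambientEll hU h.hgrad_ne
  have hDl : DifferentiableAt ℝ (fderiv ℝ (ambientEll U)) q :=
    (hl.fderiv_right (m := 1) (by norm_num)).differentiableAt (by norm_num)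
  have hsymm : IsSymmSndFDerivAt ℝ (ambientEll U) q := hl.isSymmSndFDerivAt (by simp)
  -- Differentiate `V l = 0` along `w`, where `V` is the projection of `v` to `ξ'`.
  have key : ∀ v ∈ xiPrime F p, ∀ w ∈ xiPrime F p,
      fderiv ℝ (fderiv ℝ (ambientEll U)) q (frame q w) (frame q v) +
      fderiv ℝ (ambientEll U) q
        (frame q (fderiv ℝ (projField N v) q (frame q w)) + inner ℝ w (J n v) • reeb n) = 0 := by
    intro v hv w hw
    obtain ⟨hv1, hv2⟩ := h.inner_eq_zero_of_mem hF hv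
    have hVd := ((contDiffAt_projField (v := v) hN3).differentiableAt (by norm_num)).hasFDerivAt
    have hVq : projField N v q = v := projField_eq hv1 hv2
    obtain ⟨hfV, hfV'⟩ := hasFDerivAt_frame_apply hVd (frame q w)
    have hΦ0 : HasFDerivAt
        (fun x => fderiv ℝ (ambientEll U) x (frame x (projField N v x))) _ q :=
      hDl.hasFDerivAt.clm_apply hfV.hasFDerivAt
    have hΦ := fderiv_eq_zero_of_eventually hF hΦ0.differentiableAt (by
      filter_upwards [h.eventually hF] with p' hp'
      exact (codazzi hn hF humb hH hU hp').1 _ (hp'.projField_mem hF v))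
      (show frame q w ∈ tangentPlane F p from hw.1)
    have hfst : (frame q w).1 = w := rfl
    rw [hΦ0.fderiv] at hΦ
    simp only [add_apply, ContinuousLinearMap.comp_apply, ContinuousLinearMap.flip_apply, hfV',
      hVq, hfst] at hΦ
    linear_combination hΦ
  obtain ⟨v, hv, hv0⟩ := h.exists_mem_xiPrime hn hF
  have hJv := h.J_mem_xiPrime hF hv
  have h1 := key v hv _ hJv
  have h2 := key _ hJv v hv
  have hs := hsymm.eq (frame q v) (frame q (J n v))
  obtain ⟨hv1, hv2⟩ := h.inner_eq_zero_of_mem hF hv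
  obtain ⟨hJv1, hJv2⟩ := h.inner_eq_zero_of_mem hF hJv
  have hJN : J n (N q) = -e p := by rw [h.field_eq, neg_neg]
  rw [fderiv_projField hNd hv1 hv2, hDξ _ hJv] at h1
  rw [fderiv_projField hNd hJv1 hJv2, hDξ _ hv] at h2
  rw [h.horNormal_eq]
  simp only [J_J, map_add, map_neg, map_smul, inner_add_right, inner_neg_right,
    inner_smul_right, inner_J_self, inner_J_self', inner_J_J, hJN, smul_neg, smul_eq_mul,
    neg_neg, mul_zero] at h1 h2
  have hvv : inner ℝ v v ≠ (0 : ℝ) := inner_self_ne_zero.2 hv0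
  refine (mul_eq_zero.1 (?_ : inner ℝ v v * _ = (0 : ℝ))).resolve_left hvv
  -- The Hessian terms cancel, leaving the commutator of the extensions of `v` and `J v`, which up
  -- to sign is `2 |v|² (T + α e_{2n} + k e_n)`.
  linear_combination (1 / 2) * (h1 - h2 + hs)

/-- The derivative of `l` along a curve in the regular part. -/
theorem hasDerivAt_ell (hn : 2 ≤ n) (hF : IsImmersedHypersurface F)
    (he : IsCharacteristicField F e) (humb : IsUmbilicHypersurface F e) {c : ℝ}
    (hH : ∀ p, IsRegular F p → pMeanCurvature F e p = c)
    {γ : ℝ → M} {s : ℝ} {X : Heis n} (hγ : ContinuousAt γ s) (hX : HasDerivAt (F ∘ γ) X s)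
    (hp : IsRegular F (γ s)) :
    HasDerivAt (fun t => ell F e (γ t))
      (-(2 * (n * ell F e (γ s) - c) * (alpha F e (γ s) * (inner ℝ (e (γ s)) X.1 -
        (c - ell F e (γ s)) / (2 * n - 2) * contactForm (F (γ s)) X)))) s := by
  obtain ⟨U, hU, h⟩ := exists_smooth_isAdapted he hF hp
  have hd : DifferentiableAt ℝ (ambientEll U) (F (γ s)) :=
    (contDiffAt_ambientEll hU h.hgrad_ne).differentiableAt (by norm_num)
  have h1 : HasDerivAt (ambientEll U ∘ (F ∘ γ)) (fderiv ℝ (ambientEll U) (F (γ s)) X) s :=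
    hd.hasFDerivAt.comp_hasDerivAt s hX
  have h2 : (fun t => ell F e (γ t)) =ᶠ[𝓝 s] ambientEll U ∘ (F ∘ γ) := by
    filter_upwards [hγ.eventually (h.eventually hF)] with t ht
    exact (ht.ambientEll_eq hF).symm
  refine (h1.congr_of_eventuallyEq h2).congr_deriv ?_
  have h3 : HasDerivAt (U ∘ (F ∘ γ)) (fderiv ℝ U (F (γ s)) X) s :=
    (h.contDiffAt.differentiableAt (by norm_num)).hasFDerivAt.comp_hasDerivAt s hX
  have h4 : HasDerivAt (U ∘ (F ∘ γ)) 0 s :=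
    (hasDerivAt_const s (0 : ℝ)).congr_of_eventuallyEq (hγ.eventually h.vanishing)
  have hUX := h3.unique h4
  have hNN : inner ℝ (horNormal e (γ s)) (horNormal e (γ s)) = (1 : ℝ) := by
    rw [real_inner_self_eq_norm_sq, h.norm_horNormal, one_pow]
  have hee : inner ℝ (e (γ s)) (e (γ s)) = (1 : ℝ) := by
    rw [real_inner_self_eq_norm_sq, h.norm_field, one_pow]
  have hNe := (h.mem_horTangent hF).1 (h.field_mem hF)
  obtain ⟨hc1, hc2⟩ := codazzi hn hF humb hH hU h
  have hc3 := codazzi_vertical hn hF humb hH hU h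
  have hpos := h.norm_pos
  have hα : alpha F e (γ s) * ‖hgrad U (F (γ s))‖ = -fderiv ℝ U (F (γ s)) (reeb n) := by
    rw [h.alpha_eq hF]
    field_simp
  set q := F (γ s)
  set N := horNormal e (γ s)
  set E := e (γ s)
  set θ := contactForm q X
  have hXdec := eq_frame_add q X
  -- Tangency fixes the normal component, so `X = ⟨e_n, X⟩ e_n + θ (α e_{2n} + T)` modulo `ξ'`,
  -- where `θ = Θ(X)`. The Codazzi equations evaluate `dl` on each summand.
  have hb : inner ℝ N X.1 = θ * alpha F e (γ s) := by
    rw [hXdec, map_add, map_smul, ← inner_hgrad, h.inner_hgrad_eq] at hUX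
    apply mul_left_cancel₀ hpos.ne'
    simp only [smul_eq_mul] at hUX
    linear_combination hUX - θ * hα
  have hmem : X.1 - (inner ℝ E X.1 • E + inner ℝ N X.1 • N) ∈ xiPrime F (γ s) := by
    rw [h.mem_xiPrime hF]
    simp only [inner_sub_right, inner_add_right, inner_smul_right]
    rw [hNe, hNN, hee, real_inner_comm N E, hNe]
    constructor <;> ring
  have h5 := hc1 _ hmem
  rw [map_sub, map_add, map_smul, map_smul, map_sub, map_add, map_smul, map_smul] at h5
  have hdl := congrArg (fderiv ℝ (ambientEll U) q) hXdec
  rw [map_add, map_smul] at hdl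
  rw [hdl]
  simp only [smul_eq_mul] at h5 ⊢
  rw [hb] at h5
  linear_combination h5 + θ * hc3 + (inner ℝ E X.1 - θ * ((c - ell F e (γ s)) / (2 * n - 2))) * hc2

end Codazzi

/-! ### Unique continuation of `n l = c` in the regular part. -/

section Propagation

set_option linter.unusedSectionVars false

variable {n : ℕ} {M : Type*} [TopologicalSpace M]
  [ChartedSpace (EuclideanSpace ℝ (Fin (2 * n))) M]
  {F : M → Heis n} {e : M → Hor n} {p : M}

theorem eventually_isRegular (hF : IsImmersedHypersurface F) (he : IsCharacteristicField F e)
    (hp : IsRegular F p) : ∀ᶠ q in 𝓝 p, IsRegular F q := by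
  obtain ⟨U, -, h⟩ := exists_smooth_isAdapted he hF hp
  filter_upwards [h.eventually hF] with q hq using hq.isRegular hF

theorem continuousAt_ell (hF : IsImmersedHypersurface F) (he : IsCharacteristicField F e)
    (hp : IsRegular F p) : ContinuousAt (ell F e) p := by
  obtain ⟨U, hU, h⟩ := exists_smooth_isAdapted he hF hp
  have h1 : ContinuousAt (ambientEll U ∘ F) p :=
    (contDiffAt_ambientEll hU h.hgrad_ne).continuousAt.comp hF.continuous.continuousAt
  refine h1.congr ?_
  filter_upwards [h.eventually hF] with q hq using hq.ambientEll_eq hF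

theorem continuousAt_alpha (hF : IsImmersedHypersurface F) (he : IsCharacteristicField F e)
    (hp : IsRegular F p) : ContinuousAt (alpha F e) p := by
  obtain ⟨U, hU, h⟩ := exists_smooth_isAdapted he hF hp
  have h1 : ContinuousAt (ambientAlpha U ∘ F) p :=
    (contDiffAt_ambientAlpha hU h.hgrad_ne).continuousAt.comp hF.continuous.continuousAt
  refine h1.congr ?_
  filter_upwards [h.eventually hF] with q hq using hq.ambientAlpha_eq hF

theorem abs_contactForm_le (q X : Heis n) : |contactForm q X| ≤ (1 + ‖q‖) * ‖X‖ := by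
  rw [contactForm_apply]
  have h1 : |X.2| ≤ ‖X‖ := norm_snd_le X
  have h2 : |inner ℝ q.1 (J n X.1)| ≤ ‖q.1‖ * ‖J n X.1‖ := abs_real_inner_le_norm _ _
  have h3 : ‖q.1‖ * ‖J n X.1‖ ≤ ‖q‖ * ‖X‖ := by
    rw [norm_J]
    exact mul_le_mul (norm_fst_le q) (norm_fst_le X) (norm_nonneg _) (norm_nonneg _)
  have h4 := abs_sub X.2 (inner ℝ q.1 (J n X.1))
  linarith

variable [IsManifold (𝓡 (2 * n)) 2 M]

theorem eventually_contDiffAt_chart (hF : IsImmersedHypersurface F) (p : M) :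
    ∀ᶠ x in 𝓝 (extChartAt (𝓡 (2 * n)) p p),
      ContDiffAt ℝ 2 (F ∘ (extChartAt (𝓡 (2 * n)) p).symm) x ∧
      ContinuousAt (extChartAt (𝓡 (2 * n)) p).symm x := by
  have ho : IsOpen (extChartAt (𝓡 (2 * n)) p).target := isOpen_extChartAt_target p
  have hc : ContDiffOn ℝ 2 (F ∘ (extChartAt (𝓡 (2 * n)) p).symm)
      (extChartAt (𝓡 (2 * n)) p).target :=
    contMDiffOn_iff_contDiffOn.1
      (hF.contMDiff.comp_contMDiffOn (contMDiffOn_extChartAt_symm p))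
  filter_upwards [ho.mem_nhds (mem_extChartAt_target p)] with x hx
  exact ⟨hc.contDiffAt (ho.mem_nhds hx),
    (continuousOn_extChartAt_symm p).continuousAt (ho.mem_nhds hx)⟩

/-- Unique continuation: `l = 2 k` propagates to a neighbourhood of a regular point. -/
theorem eventually_ell_eq (hn : 2 ≤ n) (hF : IsImmersedHypersurface F)
    (he : IsCharacteristicField F e) (humb : IsUmbilicHypersurface F e) {c : ℝ}
    (hH : ∀ p, IsRegular F p → pMeanCurvature F e p = c)
    (hp : IsRegular F p) (h0 : n * ell F e p = c) :
    ∀ᶠ q in 𝓝 p, n * ell F e q = c := by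
  set ψ := extChartAt (𝓡 (2 * n)) p with hψ
  set x₀ := ψ p with hx₀
  set f := F ∘ ψ.symm with hf
  have hψx : ψ.symm x₀ = p := extChartAt_to_inv p
  let k : M → ℝ := fun q => (c - ell F e q) / (2 * n - 2)
  -- In the chart, `K x ‖v‖` bounds the rate in the linear equation for `n l - c` along the
  -- direction `v`. By continuity `K` is bounded on a small ball.
  let K : EuclideanSpace ℝ (Fin (2 * n)) → ℝ := fun x => 2 * n * (|alpha F e (ψ.symm x)| *
    ((1 + |k (ψ.symm x)| * (1 + ‖f x‖)) * ‖fderiv ℝ f x‖))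
  have hch := eventually_contDiffAt_chart hF p
  obtain ⟨hfc, hψc⟩ := hch.self_of_nhds
  have hK : ContinuousAt K x₀ := by
    have ha : ContinuousAt (fun x => alpha F e (ψ.symm x)) x₀ :=
      ContinuousAt.comp (g := alpha F e) (by
        rw [hψx]; exact continuousAt_alpha hF he hp) hψc
    have hl : ContinuousAt (fun x => ell F e (ψ.symm x)) x₀ :=
      ContinuousAt.comp (g := ell F e) (by
        rw [hψx]; exact continuousAt_ell hF he hp) hψc
    have hk : ContinuousAt (fun x => k (ψ.symm x)) x₀ :=
      (continuousAt_const.sub hl).div_const _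
    have hD : ContinuousAt (fderiv ℝ f) x₀ :=
      (hfc.fderiv_right (m := 1) (by norm_num)).continuousAt
    exact continuousAt_const.mul (ha.abs.mul ((continuousAt_const.add (hk.abs.mul
      (continuousAt_const.add hfc.continuousAt.norm))).mul hD.norm))
  have hreg : ∀ᶠ x in 𝓝 x₀, IsRegular F (ψ.symm x) :=
    hψc.eventually (by rw [hψx]; exact eventually_isRegular hF he hp)
  have hKb : ∀ᶠ x in 𝓝 x₀, K x < K x₀ + 1 := hK.eventually (gt_mem_nhds (lt_add_one _))
  obtain ⟨r, hr, hball⟩ := Metric.eventually_nhds_iff_ball.1 (hch.and (hreg.and hKb))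
  have main : ∀ x ∈ Metric.ball x₀ r, n * ell F e (ψ.symm x) = c := by
    intro x hx
    let γ : ℝ → M := fun s => ψ.symm (x₀ + s • (x - x₀))
    have hmem : ∀ s ∈ Set.Icc (0 : ℝ) 1, x₀ + s • (x - x₀) ∈ Metric.ball x₀ r := fun s hs =>
      (convex_ball x₀ r).add_smul_sub_mem (Metric.mem_ball_self hr) hx hs
    let W : ℝ → ℝ := fun s => n * ell F e (γ s) - c
    have hline : ∀ s : ℝ, HasDerivAt (fun s : ℝ => x₀ + s • (x - x₀)) (x - x₀) s := fun s => by
      simpa using ((hasDerivAt_id s).smul_const (x - x₀)).const_add x₀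
    have hW : ∀ s ∈ Set.Icc (0 : ℝ) 1, ∃ W', HasDerivAt W W' s ∧
        ‖W'‖ ≤ (K x₀ + 1) * r * ‖W s‖ := by
      intro s hs
      obtain ⟨⟨hc1, hc2⟩, hr1, hk1⟩ := hball _ (hmem s hs)
      set y := x₀ + s • (x - x₀) with hy
      have hX : HasDerivAt (F ∘ γ) (fderiv ℝ f y (x - x₀)) s :=
        (hc1.differentiableAt (by norm_num)).hasFDerivAt.comp_hasDerivAt s (hline s)
      have hγ : ContinuousAt γ s :=
        ContinuousAt.comp (g := ψ.symm) (f := fun s : ℝ => x₀ + s • (x - x₀)) hc2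
          (hline s).continuousAt
      have hd := ((hasDerivAt_ell hn hF he humb hH hγ hX hr1).const_mul (n : ℝ)).sub_const c
      refine ⟨_, hd, ?_⟩
      set X := fderiv ℝ f y (x - x₀)
      have hXn : ‖X‖ ≤ ‖fderiv ℝ f y‖ * r :=
        (ContinuousLinearMap.le_opNorm _ _).trans
          (mul_le_mul_of_nonneg_left (mem_ball_iff_norm.1 hx).le (norm_nonneg _))
      have he1 : |inner ℝ (e (γ s)) X.1| ≤ ‖X‖ := by
        have := abs_real_inner_le_norm (e (γ s)) X.1
        rw [he.norm_eq_one _ hr1, one_mul] at this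
        exact this.trans (norm_fst_le X)
      have hθ : |contactForm (F (γ s)) X| ≤ (1 + ‖f y‖) * ‖X‖ := abs_contactForm_le _ X
      have hin : |inner ℝ (e (γ s)) X.1 - k (γ s) * contactForm (F (γ s)) X| ≤
          (1 + |k (ψ.symm y)| * (1 + ‖f y‖)) * (‖fderiv ℝ f y‖ * r) := by
        calc _ ≤ |inner ℝ (e (γ s)) X.1| + |k (γ s) * contactForm (F (γ s)) X| := abs_sub _ _
          _ ≤ ‖X‖ + |k (γ s)| * ((1 + ‖f y‖) * ‖X‖) := by rw [abs_mul]; gcongr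
          _ = (1 + |k (γ s)| * (1 + ‖f y‖)) * ‖X‖ := by ring
          _ ≤ _ := by gcongr
      have hexp : ‖(n : ℝ) * -(2 * (n * ell F e (γ s) - c) * (alpha F e (γ s) *
          (inner ℝ (e (γ s)) X.1 - k (γ s) * contactForm (F (γ s)) X)))‖ ≤ K y * r * ‖W s‖ := by
        rw [Real.norm_eq_abs, abs_mul, abs_neg, abs_mul, abs_mul, abs_mul, Nat.abs_cast, abs_two]
        calc _ ≤ n * (2 * |n * ell F e (γ s) - c| * (|alpha F e (γ s)| *
              ((1 + |k (ψ.symm y)| * (1 + ‖f y‖)) * (‖fderiv ℝ f y‖ * r)))) := by gcongr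
          _ = K y * r * ‖W s‖ := by
            simp only [K, W, Real.norm_eq_abs]
            change _ = 2 * n * (|alpha F e (γ s)| * _) * r * _
            ring
      refine hexp.trans ?_
      gcongr
    choose! W' hW1 hW2 using hW
    -- Grönwall along the segment from the centre, where `W` vanishes, to `x`.
    have h1 := eq_zero_of_abs_deriv_le_mul_abs_self_of_eq_zero_right (f := W) (f' := W')
      (a := 0) (b := 1)
      (fun s hs => (hW1 s hs).continuousAt.continuousWithinAt)
      (fun s hs => (hW1 s ⟨hs.1, hs.2.le⟩).hasDerivWithinAt)
      (by simp [W, γ, hψx, h0]) (fun s hs => hW2 s ⟨hs.1, hs.2.le⟩) 1 ⟨zero_le_one, le_refl _⟩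
    simp only [W, γ, one_smul, add_sub_cancel] at h1
    linarith
  have hcont : ContinuousAt ψ p := continuousAt_extChartAt p
  filter_upwards [hcont.eventually (Metric.ball_mem_nhds x₀ hr), extChartAt_source_mem_nhds (I := 𝓡 (2 * n)) p]
    with q hq hs
  have := main _ hq
  rwa [ψ.left_inv hs] at this

end Propagation

/-! ### Linear algebra: the limit form forces the symmetric part to vanish. -/

section LimitHessian

variable {n : ℕ}

/-- The normal form, relative to the normal direction `ν`, of the symmetric part of the
linearized horizontal gradient at a singular point. -/
def HasLimitForm (S : Hor n →ₗ[ℝ] Hor n) (ν : Hor n) : Prop :=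
  ∃ κ μ : ℝ, μ = -(2 * n - 2) * κ ∧
    (∀ v w, inner ℝ ν v = 0 → inner ℝ (J n ν) v = 0 → inner ℝ ν w = 0 →
      inner ℝ (S v) w = κ * inner ℝ v w) ∧
    ∀ w, inner ℝ ν w = 0 → inner ℝ (S (J n ν)) w = μ * inner ℝ (J n ν) w

variable {S : Hor n →ₗ[ℝ] Hor n}

/-- For `w ⊥ J v` the vector `ν = S w + J w` is orthogonal to `v`. Split `v = u + b J ν` with `u ⊥
ν, J ν`. The limit form makes `⟨S v, J u⟩` zero, while `S v = -J v` makes it `-|u|²`. So `u = 0`,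
and `ν` is a multiple of `J v`. -/
theorem exists_eq_smul_of_mem_ker (hS : S.IsSymmetric)
    (hform : ∀ w, S w + J n w ≠ 0 → HasLimitForm S (S w + J n w)) {v w : Hor n} (hv0 : v ≠ 0)
    (hv : S v = -J n v) (hw : inner ℝ w (J n v) = 0) : ∃ a : ℝ, S w + J n w = a • J n v := by
  by_cases hν0 : S w + J n w = 0
  · exact ⟨0, by rw [hν0, zero_smul]⟩
  obtain ⟨κ, μ, -, h1, h2⟩ := hform w hν0
  set ν := S w + J n w with hν
  have hνv : inner ℝ ν v = (0 : ℝ) := by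
    rw [hν, inner_add_left, hS, hv, inner_neg_right, inner_J_left, hw]
    norm_num
  have hνν : inner ℝ ν ν ≠ (0 : ℝ) := inner_self_ne_zero.2 hν0
  set b := inner ℝ (J n ν) v / inner ℝ ν ν with hb
  set u := v - b • J n ν with hu
  have hvu : v = u + b • J n ν := by rw [hu]; abel
  have hu1 : inner ℝ ν u = (0 : ℝ) := by
    rw [hu, inner_sub_right, inner_smul_right, inner_J_self, hνv]
    ring
  have hu2 : inner ℝ (J n ν) u = (0 : ℝ) := by
    rw [hu, inner_sub_right, inner_smul_right, inner_J_J, hb]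
    field_simp
    ring
  have hu3 : inner ℝ ν (J n u) = (0 : ℝ) := by rw [inner_J_right, hu2, neg_zero]
  have h3 : inner ℝ (S v) (J n u) = -inner ℝ u u := by
    rw [hv, inner_neg_left, inner_J_J]
    conv_lhs => enter [1, 2]; rw [hvu]
    rw [inner_add_left, real_inner_smul_left, hu2]
    ring
  have h4 : inner ℝ (S v) (J n u) = (0 : ℝ) := by
    conv_lhs => enter [2]; rw [hvu]
    rw [map_add, map_smul, inner_add_left, real_inner_smul_left, h1 _ _ hu1 hu2 hu3,
      h2 _ hu3, inner_J_J, hu1, inner_J_self]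
    ring
  have hu0 : u = 0 := by
    rw [← inner_self_eq_zero (𝕜 := ℝ)]
    linarith
  rw [hu0, zero_add] at hvu
  have hb0 : b ≠ 0 := by
    rintro h0
    rw [h0, zero_smul] at hvu
    exact hv0 hvu
  refine ⟨-b⁻¹, ?_⟩
  rw [hvu, map_smul, J_J, smul_smul, smul_neg]
  simp [hb0]

/-- A kernel vector `v` makes `S + J` send both `w` and `J w`, for `w ⊥ v, J v`, into the line of `J
v`; hence a combination `u ≠ 0` of them is again in the kernel. Applying the same fact to `u` puts
`(S + J)(J v)` on the line of `J u`, orthogonal to `v`, although its product with `v` is `-2 |v|²`.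
-/
theorem injective_of_hasLimitForm (hn : 2 ≤ n) (hS : S.IsSymmetric)
    (hform : ∀ w, S w + J n w ≠ 0 → HasLimitForm S (S w + J n w)) {v : Hor n}
    (hv : S v + J n v = 0) : v = 0 := by
  by_contra hv0
  have hv' : S v = -J n v := eq_neg_of_add_eq_zero_left hv
  obtain ⟨w, hw0, hw1, hw2⟩ := exists_ne_zero_orthogonal hn v
  have hww : inner ℝ w w ≠ (0 : ℝ) := inner_self_ne_zero.2 hw0
  obtain ⟨a, ha⟩ := exists_eq_smul_of_mem_ker hS hform hv0 hv'
    (w := w) (by rw [real_inner_comm, hw2])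
  obtain ⟨b, hb⟩ := exists_eq_smul_of_mem_ker hS hform hv0 hv'
    (w := J n w) (by rw [inner_J_J, real_inner_comm, hw1])
  -- A second kernel vector `x • w + y • J w`, orthogonal to `v` and `J v`.
  have hxy : ∃ x y : ℝ, (x ≠ 0 ∨ y ≠ 0) ∧ x * a + y * b = 0 := by
    by_cases h : a = 0 ∧ b = 0
    · exact ⟨1, 0, Or.inl one_ne_zero, by rw [h.1]; ring⟩
    · refine ⟨b, -a, ?_, by ring⟩
      rw [neg_ne_zero]
      tauto
  obtain ⟨x, y, hne, h0⟩ := hxy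
  set u := x • w + y • J n w with hu
  have hSu : S u = -J n u := by
    rw [← sub_eq_zero, sub_neg_eq_add, hu, map_add, map_add, map_smul, map_smul, map_smul,
      map_smul]
    calc _ = x • (S w + J n w) + y • (S (J n w) + J n (J n w)) := by module
      _ = (x * a + y * b) • J n v := by rw [ha, hb]; module
      _ = 0 := by rw [h0, zero_smul]
  have huu : inner ℝ u u = (x ^ 2 + y ^ 2) * inner ℝ w w := by
    rw [hu]
    simp only [inner_add_left, inner_add_right, real_inner_smul_left, inner_smul_right,
      inner_J_self, inner_J_self', inner_J_J]
    ring
  have hu0 : u ≠ 0 := by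
    rw [← inner_self_ne_zero (𝕜 := ℝ), huu]
    refine mul_ne_zero ?_ hww
    rcases hne with h | h <;> positivity
  have hJvu : inner ℝ (J n v) (J n u) = (0 : ℝ) := by
    rw [inner_J_J, hu, inner_add_right, inner_smul_right, inner_smul_right, hw1,
      inner_J_right, hw2]
    ring
  have hJuv : inner ℝ (J n u) v = (0 : ℝ) := by
    rw [hu, map_add, map_smul, map_smul, J_J, inner_add_left, real_inner_smul_left,
      real_inner_smul_left, inner_neg_left, real_inner_comm, inner_J_right, hw2,
      real_inner_comm, hw1]
    ring
  obtain ⟨d, hd⟩ := exists_eq_smul_of_mem_ker hS hform hu0 hSu hJvu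
  have h1 : inner ℝ (S (J n v) + J n (J n v)) v = (0 : ℝ) := by
    rw [hd, real_inner_smul_left, hJuv, mul_zero]
  rw [inner_add_left, hS, hv', inner_neg_right, inner_J_J, J_J, inner_neg_left] at h1
  have : inner ℝ v v ≠ (0 : ℝ) := inner_self_ne_zero.2 hv0
  apply this
  linarith

/-- Injectivity makes `S + J` surjective, so every nonzero `ν` carries the limit form. Exchanging
the roles of `x` and some `v ⊥ x, J x` gives `κ = -(2n - 2) κ'` and `κ' = -(2n - 2) κ`. As `2n - 2 ≥
2`, both vanish, and so does the quadratic form of `S`. -/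
theorem eq_zero_of_hasLimitForm (hn : 2 ≤ n) (hS : S.IsSymmetric)
    (hform : ∀ w, S w + J n w ≠ 0 → HasLimitForm S (S w + J n w)) : S = 0 := by
  have hn' : (2 : ℝ) ≤ n := by exact_mod_cast hn
  have hinj : Function.Injective (S + J n) :=
    (injective_iff_map_eq_zero _).2 fun v hv => injective_of_hasLimitForm hn hS hform hv
  have hsurj : Function.Surjective (S + J n) := LinearMap.injective_iff_surjective.1 hinj
  have hform' : ∀ ν : Hor n, ν ≠ 0 → HasLimitForm S ν := by
    intro ν hν
    obtain ⟨w, rfl⟩ := hsurj ν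
    exact hform w hν
  -- Relative to a vector `x = J ν`.
  have hx : ∀ x : Hor n, x ≠ 0 → ∃ κ : ℝ,
      inner ℝ (S x) x = -(2 * n - 2) * κ * inner ℝ x x ∧
      ∀ v, inner ℝ x v = 0 → inner ℝ (J n x) v = 0 →
        inner ℝ (S v) v = κ * inner ℝ v v := by
    intro x hx0
    obtain ⟨κ, μ, rfl, h1, h2⟩ := hform' (-J n x) (by
      rw [neg_ne_zero, ← norm_ne_zero_iff, norm_J, norm_ne_zero_iff]
      exact hx0)
    have hJx : J n (-J n x) = x := by rw [map_neg, J_J, neg_neg]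
    rw [hJx] at h1 h2
    refine ⟨κ, h2 x (by rw [inner_neg_left, inner_J_self', neg_zero]), fun v hv1 hv2 => ?_⟩
    have hv3 : inner ℝ (-J n x) v = (0 : ℝ) := by rw [inner_neg_left, hv2, neg_zero]
    exact h1 v v hv3 hv1 hv3
  have hquad : ∀ x, inner ℝ (S x) x = (0 : ℝ) := by
    intro x
    by_cases hx0 : x = 0
    · rw [hx0, inner_zero_right]
    obtain ⟨v, hv0, hv1, hv2⟩ := exists_ne_zero_orthogonal hn x
    obtain ⟨κ, h1, h2⟩ := hx x hx0
    obtain ⟨κ', h1', h2'⟩ := hx v hv0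
    have hxx : inner ℝ x x ≠ (0 : ℝ) := inner_self_ne_zero.2 hx0
    have hvv : inner ℝ v v ≠ (0 : ℝ) := inner_self_ne_zero.2 hv0
    have e1 : κ = -(2 * n - 2) * κ' := by
      apply mul_right_cancel₀ hvv
      rw [← h2 v hv1 hv2, h1']
    have e2 : κ' = -(2 * n - 2) * κ := by
      apply mul_right_cancel₀ hxx
      rw [← h1, h2' x (by rw [real_inner_comm, hv1]) (by
        rw [real_inner_comm, inner_J_right, hv2, neg_zero])]
    have e3 : ((2 * n - 2 : ℝ) ^ 2 - 1) * κ = 0 := by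
      rw [e2] at e1
      linear_combination -e1
    have e4 : κ = 0 := by
      refine (mul_eq_zero.1 e3).resolve_left ?_
      nlinarith
    rw [h1, e4]
    ring
  exact hS.inner_map_self_eq_zero.1 hquad

end LimitHessian

/-! ### The hypersurface as a graph near a singular point. -/

section Graph

set_option linter.unusedSectionVars false

variable {n : ℕ} {M : Type*} [TopologicalSpace M]
  [ChartedSpace (EuclideanSpace ℝ (Fin (2 * n))) M]
  {F : M → Heis n} {e : M → Hor n} {p : M}

/-- Near a singular point the hypersurface is the graph of a `C²` function. -/
theorem exists_graph [IsManifold (𝓡 (2 * n)) 2 M] (hF : IsImmersedHypersurface F)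
    (hp : IsSingular F p) :
    ∃ (u : Hor n → ℝ) (φ : Hor n → M), ContDiffAt ℝ 2 u (F p).1 ∧ φ (F p).1 = p ∧
      (∀ᶠ z in 𝓝 (F p).1, ContinuousAt φ z ∧ F (φ z) = (z, u z)) ∧
      ∀ᶠ q in 𝓝 p, φ (F q).1 = q := by
  set ψ := extChartAt (𝓡 (2 * n)) p with hψ
  set x₀ := ψ p with hx₀
  set f := F ∘ ψ.symm with hf
  have hψx : ψ.symm x₀ = p := extChartAt_to_inv p
  have hch := eventually_contDiffAt_chart hF p
  obtain ⟨hfc, hψc⟩ := hch.self_of_nhds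
  have hfd : HasFDerivAt f (fderiv ℝ f x₀) x₀ :=
    (hfc.differentiableAt (by norm_num)).hasFDerivAt
  have hdiff : ∀ x, differential F p x = fderiv ℝ f x₀ x := by
    intro x
    have h1 := (hF.mdifferentiableAt p).mfderiv
    have h2 : fderivWithin ℝ (writtenInExtChartAt (𝓡 (2 * n)) 𝓘(ℝ, Heis n) p F)
        (Set.range (𝓡 (2 * n))) (extChartAt (𝓡 (2 * n)) p p) = fderiv ℝ f x₀ := by
      simp only [writtenInExtChartAt, extChartAt_model_space_eq_id, PartialEquiv.refl_coe,
        Function.id_comp, modelWithCornersSelf_coe, Set.range_id, fderivWithin_univ]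
      rfl
    exact congrArg (fun L : EuclideanSpace ℝ (Fin (2 * n)) →L[ℝ] Heis n => L x) (h1.trans h2)
  let L : EuclideanSpace ℝ (Fin (2 * n)) →ₗ[ℝ] Hor n :=
    (LinearMap.fst ℝ (Hor n) ℝ) ∘ₗ (fderiv ℝ f x₀).toLinearMap
  -- At a singular point the tangent plane is the contact plane, which projects injectively to `Hor
  -- n`.
  have hL : Function.Injective L := by
    refine (injective_iff_map_eq_zero L).2 fun x hx => ?_
    have h1 : (fderiv ℝ f x₀ x).1 = 0 := hx
    have h2 : differential F p x ∈ contactPlane (F p) := by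
      rw [← show tangentPlane F p = contactPlane (F p) from hp]
      exact ⟨x, rfl⟩
    have h3 : contactForm (F p) (fderiv ℝ f x₀ x) = 0 :=
      (congrArg (contactForm (F p)) (hdiff x)).symm.trans h2
    rw [contactForm_apply, h1, map_zero, inner_zero_right, sub_zero] at h3
    apply hF.injective_differential p
    exact ((hdiff x).trans (Prod.ext h1 h3)).trans (map_zero (differential F p)).symm
  let A : EuclideanSpace ℝ (Fin (2 * n)) ≃L[ℝ] Hor n :=
    (L.linearEquivOfInjective hL (by rw [finrank_Hor, finrank_euclideanSpace_fin])).toContinuousLinearEquiv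
  have hgd : HasFDerivAt (fun x => (f x).1) (A : EuclideanSpace ℝ (Fin (2 * n)) →L[ℝ] Hor n) x₀ :=
    hfd.fst.congr_fderiv (by ext1 x; rfl)
  have hgc : ContDiffAt ℝ 2 (fun x => (f x).1) x₀ := hfc.fst
  let h := hgc.toOpenPartialHomeomorph _ hgd (by norm_num)
  have hcoe : ∀ x, h x = (f x).1 := fun x => rfl
  have hxs : x₀ ∈ h.source := hgc.mem_toOpenPartialHomeomorph_source hgd (by norm_num)
  have hinv : ContDiffAt ℝ 2 h.symm ((f x₀).1) := hgc.to_localInverse hgd (by norm_num)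
  have hfx : f x₀ = F p := by rw [hf, Function.comp_apply, hψx]
  have hz₀ : h x₀ = (F p).1 := by rw [hcoe, hfx]
  have hsymm : h.symm (F p).1 = x₀ := by rw [← hz₀, h.left_inv hxs]
  have hzt : (F p).1 ∈ h.target := hz₀ ▸ h.map_source hxs
  rw [hfx] at hinv
  -- `F` is only immersed, so `φ` keeps track of the sheet through `p` by lifting the graph to `M`.
  refine ⟨fun z => (f (h.symm z)).2, fun z => ψ.symm (h.symm z), ?_, ?_, ?_, ?_⟩
  · exact (ContDiffAt.comp (g := f) _ (by rw [hsymm]; exact hfc) hinv).snd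
  · simp only [hsymm, hψx]
  · have h1 : ∀ᶠ z in 𝓝 (F p).1, ContinuousAt ψ.symm (h.symm z) := by
      refine hinv.continuousAt.eventually ?_
      rw [hsymm]
      exact hch.mono fun x hx => hx.2
    filter_upwards [h1, h.open_target.mem_nhds hzt] with z hz hzt
    refine ⟨ContinuousAt.comp (g := ψ.symm) hz (h.continuousAt_symm hzt), Prod.ext ?_ rfl⟩
    exact h.right_inv hzt
  · have h1 : ∀ᶠ q in 𝓝 p, ψ q ∈ h.source :=
      (continuousAt_extChartAt p).eventually (h.open_source.mem_nhds hxs)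
    filter_upwards [h1, extChartAt_source_mem_nhds (I := 𝓡 (2 * n)) p] with q hq hqs
    have h2 : (F q).1 = h (ψ q) := by
      rw [hcoe, hf, Function.comp_apply, ψ.left_inv hqs]
    rw [h2, h.left_inv hq, ψ.left_inv hqs]

/-- The defining function of the graph of `u`. -/
def graphFun (u : Hor n → ℝ) (q : Heis n) : ℝ := u q.1 - q.2

/-- The horizontal gradient of the graph of `u`, as a field on the base. -/
def graphGrad (u : Hor n → ℝ) (z : Hor n) : Hor n := hgrad (graphFun u) (z, 0)

variable {u : Hor n → ℝ} {z : Hor n}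

theorem contDiffAt_graphFun {q : Heis n} {m : WithTop ℕ∞} (hu : ContDiffAt ℝ m u q.1) :
    ContDiffAt ℝ m (graphFun u) q :=
  (hu.comp q contDiffAt_fst).sub contDiffAt_snd

theorem fderiv_graphFun {q : Heis n} (hu : DifferentiableAt ℝ u q.1) (X : Heis n) :
    fderiv ℝ (graphFun u) q X = fderiv ℝ u q.1 X.1 - X.2 := by
  have : HasFDerivAt (graphFun u) _ q :=
    (hu.hasFDerivAt.comp q hasFDerivAt_fst).sub hasFDerivAt_snd
  rw [this.fderiv]
  rfl

theorem hgrad_graphFun {q : Heis n} (hu : DifferentiableAt ℝ u q.1) :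
    hgrad (graphFun u) q = graphGrad u q.1 := by
  refine ext_inner_right ℝ fun v => ?_
  rw [graphGrad, inner_hgrad, inner_hgrad, fderiv_graphFun hu,
    fderiv_graphFun (q := (q.1, 0)) hu, frame_apply, frame_apply]

theorem inner_graphGrad (hu : DifferentiableAt ℝ u z) (v : Hor n) :
    inner ℝ (graphGrad u z) v = fderiv ℝ u z v + inner ℝ (J n z) v := by
  rw [graphGrad, inner_hgrad, fderiv_graphFun (q := (z, 0)) hu, frame_apply, inner_J_left]
  ring

theorem contDiffAt_graphGrad (hu : ContDiffAt ℝ 2 u z) : ContDiffAt ℝ 1 (graphGrad u) z :=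
  ContDiffAt.comp (g := hgrad (graphFun u)) (f := fun z => ((z, 0) : Heis n)) z
    (contDiffAt_hgrad (k := 2) (contDiffAt_graphFun (q := (z, 0)) hu) (by norm_num))
    (contDiffAt_id.prodMk contDiffAt_const)

/-- From `G = ∇u + J z`: the symmetric part of `DG` is the Hessian of `u`, and the skew part is
always `J`. -/
theorem inner_fderiv_graphGrad (hu : ContDiffAt ℝ 2 u z) (w v : Hor n) :
    inner ℝ (fderiv ℝ (graphGrad u) z w) v =
      fderiv ℝ (fderiv ℝ u) z w v + inner ℝ (J n w) v := by
  have hG : DifferentiableAt ℝ (graphGrad u) z :=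
    (contDiffAt_graphGrad hu).differentiableAt (by norm_num)
  have hD : DifferentiableAt ℝ (fderiv ℝ u) z :=
    (hu.fderiv_right (m := 1) (by norm_num)).differentiableAt (by norm_num)
  have h1 := fderiv_inner_apply ℝ hG (differentiableAt_const v) w
  have h2 : (fun x => inner ℝ (graphGrad u x) v) =ᶠ[𝓝 z]
      fun x => fderiv ℝ u x v + inner ℝ (JL n x) v := by
    filter_upwards [hu.eventually (by simp)] with x hx
    exact inner_graphGrad (hx.differentiableAt (by norm_num)) v
  have h3 : HasFDerivAt (fun x => fderiv ℝ u x v + inner ℝ (JL n x) v) _ z :=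
    (hD.hasFDerivAt.clm_apply (hasFDerivAt_const v z)).add
      ((JL n).hasFDerivAt.inner ℝ (hasFDerivAt_const v z))
  rw [h2.fderiv_eq, h3.fderiv] at h1
  simpa using h1.symm

/-- The normal form of an umbilic graph at a regular point, in terms of the horizontal
gradient. -/
theorem graph_normal_form (hn : 2 ≤ n) (hF : IsImmersedHypersurface F)
    (he : IsCharacteristicField F e) (humb : IsUmbilicHypersurface F e) {c : ℝ}
    (hH : ∀ p, IsRegular F p → pMeanCurvature F e p = c) {q : M}
    (hu : ContDiffAt ℝ 2 u (F q).1) (h0 : ∀ᶠ q' in 𝓝 q, graphFun u (F q') = 0)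
    (hG : graphGrad u (F q).1 ≠ 0) :
    IsRegular F q ∧ ∃ ε : ℝ, ε ^ 2 = 1 ∧
      alpha F e q = ε * ‖graphGrad u (F q).1‖⁻¹ ∧
      e q = -((ε * ‖graphGrad u (F q).1‖⁻¹) • J n (graphGrad u (F q).1)) ∧
      (∀ v w, inner ℝ (graphGrad u (F q).1) v = 0 → inner ℝ (J n (graphGrad u (F q).1)) v = 0 →
        inner ℝ (graphGrad u (F q).1) w = 0 →
        inner ℝ (fderiv ℝ (graphGrad u) (F q).1 v) w =
          -(ε * ‖graphGrad u (F q).1‖ * ((c - ell F e q) / (2 * n - 2))) * inner ℝ v w +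
            inner ℝ (J n v) w) ∧
      ∀ w, inner ℝ (graphGrad u (F q).1) w = 0 →
        inner ℝ (fderiv ℝ (graphGrad u) (F q).1 (J n (graphGrad u (F q).1))) w =
          -(ε * ‖graphGrad u (F q).1‖ * ell F e q) *
            inner ℝ (J n (graphGrad u (F q).1)) w := by
  have hn' : (2 : ℝ) ≤ n := by exact_mod_cast hn
  have hn0 : (2 * n - 2 : ℝ) ≠ 0 := by linarith
  have hud : DifferentiableAt ℝ u (F q).1 := hu.differentiableAt (by norm_num)
  have hgq : hgrad (graphFun u) (F q) = graphGrad u (F q).1 := hgrad_graphFun hud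
  -- The given `e_n` selects `graphFun u` or its negative. The sign `ε` enters the curvature terms,
  -- but only as `ε² = 1` in the `J` term.
  have hsign : ∃ (ε : ℝ) (V : Heis n → ℝ), ε ^ 2 = 1 ∧ IsAdapted F e V q ∧
      (∀ x, hgrad V x = ε • hgrad (graphFun u) x) ∧
      fderiv ℝ V (F q) (reeb n) = ε * fderiv ℝ (graphFun u) (F q) (reeb n) := by
    rcases exists_isAdapted he hF (contDiffAt_graphFun hu) h0 (by rwa [hgq]) with h | h
    · exact ⟨1, _, by norm_num, h, fun x => by rw [one_smul], by rw [one_mul]⟩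
    · refine ⟨-1, _, by norm_num, h, fun x => by rw [hgrad_neg, neg_one_smul], ?_⟩
      rw [fderiv_fun_neg]
      simp
  obtain ⟨ε, V, hε, h, hV1, hV2⟩ := hsign
  have hεabs : |ε| = 1 := by
    rw [← abs_one, ← sq_eq_sq_iff_abs_eq_abs, hε, one_pow]
  have hVq : hgrad V (F q) = ε • graphGrad u (F q).1 := by rw [hV1, hgq]
  have hnorm : ‖hgrad V (F q)‖ = ‖graphGrad u (F q).1‖ := by
    rw [hVq, norm_smul, Real.norm_eq_abs, hεabs, one_mul]
  have hreg := h.isRegular hF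
  obtain ⟨k, -, h1, h2, h3⟩ := h.exists_normal_form hn hF (humb q hreg)
  rw [hH q hreg] at h3
  have hk : (c - ell F e q) / (2 * n - 2) = k := by
    rw [div_eq_iff hn0]
    linarith
  have hα : alpha F e q = ε * ‖graphGrad u (F q).1‖⁻¹ := by
    rw [h.alpha_eq hF, hV2, hnorm, fderiv_graphFun hud]
    simp [reeb]
    ring
  have heq : e q = -((ε * ‖graphGrad u (F q).1‖⁻¹) • J n (graphGrad u (F q).1)) := by
    rw [h.field_eq, unitGrad, hnorm, hVq, map_smul, map_smul, smul_smul, mul_comm]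
  refine ⟨hreg, ε, hε, hα, heq, ?_, ?_⟩
  all_goals
    have hfd : ∀ X : Heis n, fderiv ℝ (hgrad V) (F q) X =
        ε • fderiv ℝ (graphGrad u) (F q).1 X.1 := by
      intro X
      have hd : HasFDerivAt (fun x : Heis n => ε • graphGrad u x.1) _ (F q) :=
        (((contDiffAt_graphGrad hu).differentiableAt (by norm_num)).hasFDerivAt.comp (F q)
          hasFDerivAt_fst).const_smul ε
      have hev : hgrad V =ᶠ[𝓝 (F q)] fun x : Heis n => ε • graphGrad u x.1 := by
        have : ∀ᶠ x : Heis n in 𝓝 (F q), ContDiffAt ℝ 2 u x.1 :=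
          continuousAt_fst.eventually (hu.eventually (by simp))
        filter_upwards [this] with x hx
        rw [hV1, hgrad_graphFun (hx.differentiableAt (by norm_num))]
      rw [hev.fderiv_eq, hd.fderiv]
      rfl
    have key : ∀ v w, inner ℝ (graphGrad u (F q).1) w = 0 →
        inner ℝ (fderiv ℝ (graphGrad u) (F q).1 v) w = ε * ‖graphGrad u (F q).1‖ *
          inner ℝ (fderiv ℝ (unitGrad V) (F q) (frame (F q) v)) w := by
      intro v w hw
      have hfst : (frame (F q) v).1 = v := rfl
      have hw' : inner ℝ (hgrad V (F q)) w = 0 := by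
        rw [hVq, real_inner_smul_left, hw, mul_zero]
      have hpos : ‖graphGrad u (F q).1‖ ≠ 0 := norm_ne_zero_iff.2 hG
      rw [inner_fderiv_unitGrad h.contDiffAt h.hgrad_ne _ hw', hfd, hfst, real_inner_smul_left,
        hnorm]
      field_simp
      linear_combination -(inner ℝ (fderiv ℝ (graphGrad u) (F q).1 v) w) * hε
    have hpos : ‖graphGrad u (F q).1‖ ≠ 0 := norm_ne_zero_iff.2 hG
    have hε0 : ε ≠ 0 := by rintro rfl; norm_num at hε
  · intro v w hv1 hv2 hw
    have hv : v ∈ xiPrime F q := by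
      rw [h.mem_xiPrime hF, horNormal, heq, map_neg, map_smul, J_J]
      simp [real_inner_smul_left, hv1, hv2]
    rw [key v w hw, h1 v hv, hk, hα, inner_add_left, inner_neg_left, real_inner_smul_left,
      real_inner_smul_left]
    field_simp
    linear_combination (inner ℝ (J n v) w) * hε
  · intro w hw
    have hJ : J n (graphGrad u (F q).1) = (-(ε * ‖graphGrad u (F q).1‖)) • e q := by
      rw [heq, smul_neg, neg_smul, neg_neg, smul_smul]
      conv_lhs => rw [← one_smul ℝ (J n (graphGrad u (F q).1))]
      congr 1
      field_simp
      rw [hε]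
    rw [key _ w hw, hJ, map_smul, map_smul, h2, smul_neg, inner_neg_left, real_inner_smul_left,
      real_inner_smul_left, real_inner_smul_left]
    ring

end Graph

/-! ### Passing to the limit in the normal forms. -/

section Limit

variable {n : ℕ}

/-- The limit form is inherited from normal forms along directions converging to `ν`. -/
theorem hasLimitForm_of_tendsto (hn : 2 ≤ n) {ι : Type*} {l : Filter ι} [l.NeBot]
    {D : ι → Hor n →L[ℝ] Hor n} {D₀ : Hor n →L[ℝ] Hor n} {N : ι → Hor n} {ν : Hor n}
    {κ μ : ι → ℝ} (hD : Filter.Tendsto D l (𝓝 D₀)) (hN : Filter.Tendsto N l (𝓝 ν)) (hν : ν ≠ 0)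
    (hκμ : Filter.Tendsto (fun i => μ i + (2 * n - 2) * κ i) l (𝓝 0))
    (h1 : ∀ᶠ i in l, ∀ v w, inner ℝ (N i) v = 0 → inner ℝ (J n (N i)) v = 0 →
      inner ℝ (N i) w = 0 → inner ℝ (D i v) w = κ i * inner ℝ v w + inner ℝ (J n v) w)
    (h2 : ∀ᶠ i in l, ∀ w, inner ℝ (N i) w = 0 →
      inner ℝ (D i (J n (N i))) w = μ i * inner ℝ (J n (N i)) w) :
    HasLimitForm (D₀.toLinearMap - J n) ν := by
  have hn' : (2 : ℝ) ≤ n := by exact_mod_cast hn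
  have hn0 : (2 * n - 2 : ℝ) ≠ 0 := by linarith
  have hn1 : (n - 1 : ℝ) ≠ 0 := by linarith
  have hνν : inner ℝ ν ν ≠ (0 : ℝ) := inner_self_ne_zero.2 hν
  have happ : ∀ {x : ι → Hor n} {x₀ : Hor n}, Filter.Tendsto x l (𝓝 x₀) →
      Filter.Tendsto (fun i => D i (x i)) l (𝓝 (D₀ x₀)) := fun {x} {x₀} hx =>
    (isBoundedBilinearMap_apply.continuous.tendsto (D₀, x₀)).comp (hD.prodMk_nhds hx)
  have hJN : Filter.Tendsto (fun i => J n (N i)) l (𝓝 (J n ν)) :=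
    ((JL n).continuous.tendsto ν).comp hN
  have hNN : Filter.Tendsto (fun i => inner ℝ (N i) (N i)) l (𝓝 (inner ℝ ν ν)) := hN.inner hN
  have hNne : ∀ᶠ i in l, inner ℝ (N i) (N i) ≠ (0 : ℝ) := hNN.eventually_ne hνν
  -- Convergence of `μ` is read off from the test vector `J N`; that of `κ` then follows from the
  -- trace relation `hκμ`.
  set μ₀ := inner ℝ (D₀ (J n ν)) (J n ν) / inner ℝ ν ν with hμ₀
  have hμ : Filter.Tendsto μ l (𝓝 μ₀) := by
    have h3 : Filter.Tendsto
        (fun i => inner ℝ (D i (J n (N i))) (J n (N i)) / inner ℝ (N i) (N i)) l (𝓝 μ₀) :=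
      ((happ hJN).inner hJN).div hNN hνν
    refine h3.congr' ?_
    filter_upwards [h2, hNne] with i hi hne
    rw [hi _ (inner_J_self _), inner_J_J]
    field_simp
  have hκ : Filter.Tendsto κ l (𝓝 (-μ₀ / (2 * n - 2))) := by
    have h3 := (hκμ.sub hμ).div_const (2 * n - 2 : ℝ)
    rw [zero_sub] at h3
    refine h3.congr fun i => ?_
    rw [add_sub_cancel_left, mul_div_cancel_left₀ _ hn0]
  -- The normal forms require vectors orthogonal to `N i`. Fixed vectors orthogonal to the limit `ν`
  -- are corrected by terms tending to zero.
  have hproj : ∀ v : Hor n, inner ℝ ν v = 0 → Filter.Tendsto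
      (fun i => (inner ℝ (N i) v / inner ℝ (N i) (N i)) • N i) l (𝓝 0) := by
    intro v hv
    have := ((hN.inner (tendsto_const_nhds (x := v))).div hNN hνν).smul hN
    rwa [hv, zero_div, zero_smul] at this
  have hprojJ : ∀ v : Hor n, inner ℝ (J n ν) v = 0 → Filter.Tendsto
      (fun i => (inner ℝ (J n (N i)) v / inner ℝ (N i) (N i)) • J n (N i)) l (𝓝 0) := by
    intro v hv
    have := ((hJN.inner (tendsto_const_nhds (x := v))).div hNN hνν).smul hJN
    rwa [hv, zero_div, zero_smul] at this
  have htail : ∀ w : Hor n, inner ℝ ν w = 0 → Filter.Tendsto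
      (fun i => w - (inner ℝ (N i) w / inner ℝ (N i) (N i)) • N i) l (𝓝 w) := by
    intro w hw
    simpa using (tendsto_const_nhds (x := w)).sub (hproj w hw)
  have horth : ∀ w : Hor n, ∀ᶠ i in l,
      inner ℝ (N i) (w - (inner ℝ (N i) w / inner ℝ (N i) (N i)) • N i) = (0 : ℝ) := by
    intro w
    filter_upwards [hNne] with i hne
    rw [inner_sub_right, inner_smul_right]
    field_simp
    ring
  refine ⟨-μ₀ / (2 * n - 2), μ₀, by rw [neg_mul, mul_div_cancel₀ _ hn0, neg_neg], fun v w hv1 hv2 hw => ?_, fun w hw => ?_⟩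
  · have hvt : Filter.Tendsto (fun i => v - ((inner ℝ (N i) v / inner ℝ (N i) (N i)) • N i +
        (inner ℝ (J n (N i)) v / inner ℝ (N i) (N i)) • J n (N i))) l (𝓝 v) := by
      simpa using (tendsto_const_nhds (x := v)).sub ((hproj v hv1).add (hprojJ v hv2))
    have hlhs := (happ hvt).inner (𝕜 := ℝ) (htail w hw)
    have hrhs := (hκ.mul (hvt.inner (𝕜 := ℝ) (htail w hw))).add
      ((((JL n).continuous.tendsto v).comp hvt).inner (𝕜 := ℝ) (htail w hw))
    have := tendsto_nhds_unique_of_eventuallyEq hlhs hrhs (by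
      filter_upwards [h1, hNne, horth w] with i hi hne hor
      refine hi _ _ ?_ ?_ hor
      · rw [inner_sub_right, inner_add_right, inner_smul_right, inner_smul_right, inner_J_self]
        field_simp
        ring
      · rw [inner_sub_right, inner_add_right, inner_smul_right, inner_smul_right, inner_J_self',
          inner_J_J]
        field_simp
        ring)
    rw [LinearMap.sub_apply, inner_sub_left]
    change inner ℝ (D₀ v) w - _ = _
    rw [this, JL_apply]
    ring
  · have hlhs := (happ hJN).inner (𝕜 := ℝ) (htail w hw)
    have hrhs := hμ.mul (hJN.inner (𝕜 := ℝ) (htail w hw))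
    have := tendsto_nhds_unique_of_eventuallyEq hlhs hrhs (by
      filter_upwards [h2, horth w] with i hi hor using hi _ hor)
    rw [LinearMap.sub_apply, inner_sub_left, J_J, inner_neg_left, hw]
    change inner ℝ (D₀ (J n ν)) w - _ = _
    rw [this]
    ring

end Limit

/-! ### The linearized horizontal gradient at a singular point. -/

section Singular

set_option linter.unusedSectionVars false

variable {n : ℕ} {M : Type*} [TopologicalSpace M]
  [ChartedSpace (EuclideanSpace ℝ (Fin (2 * n))) M]
  {F : M → Heis n} {e : M → Hor n} {p : M} {u : Hor n → ℝ} {φ : Hor n → M}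

/-- Near a singular point, the points of the graph satisfy the hypotheses of
`graph_normal_form`. -/
theorem eventually_graph (hu : ContDiffAt ℝ 2 u (F p).1) (hφp : φ (F p).1 = p)
    (hφ : ∀ᶠ z in 𝓝 (F p).1, ContinuousAt φ z ∧ F (φ z) = (z, u z))
    (hinv : ∀ᶠ q in 𝓝 p, φ (F q).1 = q) (hF : IsImmersedHypersurface F) :
    ∀ᶠ z in 𝓝 (F p).1, ContDiffAt ℝ 2 u z ∧ ContinuousAt φ z ∧
      (∀ᶠ y in 𝓝 z, F (φ y) = (y, u y)) ∧
      ∀ᶠ q in 𝓝 (φ z), graphFun u (F q) = 0 := by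
  have h1 : ∀ᶠ z in 𝓝 (F p).1, ∀ᶠ q in 𝓝 (φ z), φ (F q).1 = q := by
    refine hφ.self_of_nhds.1.eventually (p := fun m => ∀ᶠ q in 𝓝 m, φ (F q).1 = q) ?_
    rw [hφp]
    exact hinv.eventually_nhds
  filter_upwards [hu.eventually (by simp), hφ.eventually_nhds, h1] with z a b d
  have hb := b.self_of_nhds
  refine ⟨a, hb.1, b.mono fun y hy => hy.2, ?_⟩
  have hcont : Filter.Tendsto (fun q => (F q).1) (𝓝 (φ z)) (𝓝 z) := by
    have := (continuous_fst.comp hF.continuous).tendsto (φ z)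
    rwa [Function.comp_apply, hb.2] at this
  filter_upwards [d, hcont.eventually b] with q hq1 hq2
  rw [← hq1, hq2.2]
  simp [graphFun]

theorem graphGrad_eq_zero_of_isSingular (hn : 2 ≤ n) (hF : IsImmersedHypersurface F)
    (he : IsCharacteristicField F e) (humb : IsUmbilicHypersurface F e) {c : ℝ}
    (hH : ∀ p, IsRegular F p → pMeanCurvature F e p = c) (hp : IsSingular F p)
    (hu : ContDiffAt ℝ 2 u (F p).1) (h0 : ∀ᶠ q in 𝓝 p, graphFun u (F q) = 0) :
    graphGrad u (F p).1 = 0 := by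
  by_contra hG
  exact (graph_normal_form hn hF he humb hH hu h0 hG).1 hp

/-- At a singular point the linearized horizontal gradient is `J`. -/
theorem fderiv_graphGrad_of_isSingular (hn : 2 ≤ n) (hF : IsImmersedHypersurface F)
    (he : IsCharacteristicField F e) (humb : IsUmbilicHypersurface F e) {c : ℝ}
    (hH : ∀ p, IsRegular F p → pMeanCurvature F e p = c) (hp : IsSingular F p)
    (hu : ContDiffAt ℝ 2 u (F p).1) (hφp : φ (F p).1 = p)
    (hφ : ∀ᶠ z in 𝓝 (F p).1, ContinuousAt φ z ∧ F (φ z) = (z, u z))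
    (hinv : ∀ᶠ q in 𝓝 p, φ (F q).1 = q) :
    fderiv ℝ (graphGrad u) (F p).1 = JL n := by
  have hn' : (2 : ℝ) ≤ n := by exact_mod_cast hn
  have hn0 : (2 * n - 2 : ℝ) ≠ 0 := by linarith
  have hgr := eventually_graph hu hφp hφ hinv hF
  have hG0 : graphGrad u (F p).1 = 0 := graphGrad_eq_zero_of_isSingular hn hF he humb hH hp hu
    (by simpa only [hφp] using hgr.self_of_nhds.2.2.2)
  set z₀ := (F p).1 with hz₀
  set D₀ := fderiv ℝ (graphGrad u) z₀ with hD₀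
  have hGd : HasFDerivAt (graphGrad u) D₀ z₀ :=
    ((contDiffAt_graphGrad hu).differentiableAt (by norm_num)).hasFDerivAt
  have hDc : ContinuousAt (fderiv ℝ (graphGrad u)) z₀ :=
    ((contDiffAt_graphGrad hu).fderiv_right (m := 0) (by norm_num)).continuousAt
  have hS : (D₀.toLinearMap - J n).IsSymmetric := by
    intro v w
    have hs : IsSymmSndFDerivAt ℝ u z₀ := hu.isSymmSndFDerivAt (by simp)
    rw [LinearMap.sub_apply, LinearMap.sub_apply, inner_sub_left, inner_sub_right,
      real_inner_comm _ v, real_inner_comm _ v]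
    change inner ℝ (D₀ v) w - _ = inner ℝ (D₀ w) v - _
    rw [inner_fderiv_graphGrad hu, inner_fderiv_graphGrad hu, hs.eq]
    ring
  have hform : ∀ w, (D₀.toLinearMap - J n) w + J n w ≠ 0 →
      HasLimitForm (D₀.toLinearMap - J n) ((D₀.toLinearMap - J n) w + J n w) := by
    intro w hw
    rw [LinearMap.sub_apply, sub_add_cancel] at hw ⊢
    change D₀ w ≠ 0 at hw
    change HasLimitForm _ (D₀ w)
    have hline : HasDerivAt (fun s : ℝ => z₀ + s • w) w 0 := by
      simpa using ((hasDerivAt_id (0 : ℝ)).smul_const w).const_add z₀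
    have hzt : Filter.Tendsto (fun s : ℝ => z₀ + s • w) (𝓝[>] 0) (𝓝 z₀) := by
      have := hline.continuousAt.tendsto
      rw [zero_smul, add_zero] at this
      exact this.mono_left nhdsWithin_le_nhds
    have hGs : HasDerivAt (fun s : ℝ => graphGrad u (z₀ + s • w)) (D₀ w) 0 := by
      have hGd' : HasFDerivAt (graphGrad u) D₀ (z₀ + (0 : ℝ) • w) := by simpa using hGd
      exact hGd'.comp_hasDerivAt (0 : ℝ) hline
    -- Rescaling by `s⁻¹` keeps the homogeneous normal form conditions and gives the gradient
    -- direction the nonzero limit `D₀ w`.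
    have hN : Filter.Tendsto (fun s : ℝ => s⁻¹ • graphGrad u (z₀ + s • w)) (𝓝[>] 0)
        (𝓝 (D₀ w)) := by
      have := hGs.tendsto_slope_zero_right
      simpa [hG0] using this
    have hGt : Filter.Tendsto (fun s : ℝ => graphGrad u (z₀ + s • w)) (𝓝[>] 0) (𝓝 0) := by
      have := hGd.continuousAt.tendsto.comp hzt
      rwa [hG0] at this
    -- Here `κ = -ε |G| k` and `μ = -ε |G| l`, so `μ + (2n - 2) κ = -ε |G| c`, which tends to zero
    -- because `c` is fixed.
    have hnf : ∀ᶠ s : ℝ in 𝓝[>] 0, ∃ κμ : ℝ × ℝ,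
        |κμ.2 + (2 * n - 2) * κμ.1| ≤ ‖graphGrad u (z₀ + s • w)‖ * |c| ∧
        (∀ v x, inner ℝ (s⁻¹ • graphGrad u (z₀ + s • w)) v = 0 →
          inner ℝ (J n (s⁻¹ • graphGrad u (z₀ + s • w))) v = 0 →
          inner ℝ (s⁻¹ • graphGrad u (z₀ + s • w)) x = 0 →
          inner ℝ (fderiv ℝ (graphGrad u) (z₀ + s • w) v) x =
            κμ.1 * inner ℝ v x + inner ℝ (J n v) x) ∧
        ∀ x, inner ℝ (s⁻¹ • graphGrad u (z₀ + s • w)) x = 0 →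
          inner ℝ (fderiv ℝ (graphGrad u) (z₀ + s • w)
            (J n (s⁻¹ • graphGrad u (z₀ + s • w)))) x =
            κμ.2 * inner ℝ (J n (s⁻¹ • graphGrad u (z₀ + s • w))) x := by
      filter_upwards [hzt.eventually hgr, hN.eventually_ne hw, self_mem_nhdsWithin]
        with s hs hne hs0
      have hs1 : s⁻¹ ≠ 0 := inv_ne_zero (ne_of_gt hs0)
      obtain ⟨hs2, -, hs3, hs4⟩ := hs
      set z := z₀ + s • w
      have hz : (F (φ z)).1 = z := by rw [hs3.self_of_nhds]
      have hGz : graphGrad u z ≠ 0 := fun h => hne (by rw [h, smul_zero])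
      obtain ⟨-, ε, hε, -, -, hf1, hf2⟩ :=
        graph_normal_form hn hF he humb hH (by rwa [hz]) hs4 (by rwa [hz])
      rw [hz] at hf1 hf2
      have hεabs : |ε| = 1 := by rw [← abs_one, ← sq_eq_sq_iff_abs_eq_abs, hε, one_pow]
      refine ⟨(-(ε * ‖graphGrad u z‖ * ((c - ell F e (φ z)) / (2 * n - 2))),
        -(ε * ‖graphGrad u z‖ * ell F e (φ z))), ?_, ?_, ?_⟩
      · have : -(ε * ‖graphGrad u z‖ * ell F e (φ z)) + (2 * n - 2) *
            -(ε * ‖graphGrad u z‖ * ((c - ell F e (φ z)) / (2 * n - 2))) =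
            -(ε * (‖graphGrad u z‖ * c)) := by
          linear_combination -(ε * ‖graphGrad u z‖) * mul_div_cancel₀ (c - ell F e (φ z)) hn0
        simp only [this, abs_neg, abs_mul, hεabs, one_mul, abs_norm, le_refl]
      · intro v x hv1 hv2 hx
        rw [map_smul] at hv2
        rw [real_inner_smul_left] at hv1 hv2 hx
        exact hf1 v x ((mul_eq_zero.1 hv1).resolve_left hs1)
          ((mul_eq_zero.1 hv2).resolve_left hs1) ((mul_eq_zero.1 hx).resolve_left hs1)
      · intro x hx
        rw [real_inner_smul_left] at hx
        rw [map_smul, map_smul, real_inner_smul_left, real_inner_smul_left,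
          hf2 x ((mul_eq_zero.1 hx).resolve_left hs1)]
        ring
    obtain ⟨κμ, hκμ⟩ := hnf.choice
    refine hasLimitForm_of_tendsto hn (l := 𝓝[>] (0 : ℝ)) (hDc.tendsto.comp hzt) hN hw
      (κ := fun s => (κμ s).1) (μ := fun s => (κμ s).2) ?_
      (hκμ.mono fun s hs => hs.2.1) (hκμ.mono fun s hs => hs.2.2)
    refine squeeze_zero_norm' (hκμ.mono fun s hs => hs.1) ?_
    simpa using hGt.norm.mul_const |c|
  have h := eq_zero_of_hasLimitForm hn hS hform
  ext1 v
  have h1 := congrArg (fun L => L v) h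
  exact sub_eq_zero.1 h1

end Singular

/-! ### The singular linear equation along rays from a singular point. -/

section Radial

/-- A function with `f' = -a f` on `(0, R]`, `a s ≥ 2 / s`, which grows at most like `1 / s`,
vanishes. -/
theorem eq_zero_of_hasDerivAt_of_le {f a : ℝ → ℝ} {R C : ℝ} (hR : 0 < R)
    (hf : ∀ s ∈ Set.Ioc 0 R, HasDerivAt f (-(a s * f s)) s)
    (ha : ∀ s ∈ Set.Ioc 0 R, 2 ≤ s * a s) (hC : ∀ s ∈ Set.Ioc 0 R, |f s| * s ≤ C) :
    f R = 0 := by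
  -- The weight exponent `3` lies between `2` and `4`: at most `4` for monotonicity given `s a ≥ 2`,
  -- and above `2` so that the bound `|f| s ≤ C` makes the product tend to zero.
  have hg : ∀ s ∈ Set.Ioc 0 R, HasDerivAt (fun s => f s ^ 2 * s ^ 3)
      (f s ^ 2 * s ^ 2 * (3 - 2 * (s * a s))) s := by
    intro s hs
    refine (((hf s hs).pow 2).mul (hasDerivAt_pow 3 s)).congr_deriv ?_
    simp
    ring
  have hanti : AntitoneOn (fun s => f s ^ 2 * s ^ 3) (Set.Ioc 0 R) := by
    refine antitoneOn_of_deriv_nonpos (convex_Ioc 0 R)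
      (fun s hs => (hg s hs).continuousAt.continuousWithinAt)
      (fun s hs => (hg s (interior_subset hs)).differentiableAt.differentiableWithinAt)
      fun s hs => ?_
    rw [(hg s (interior_subset hs)).deriv]
    have := ha s (interior_subset hs)
    exact mul_nonpos_of_nonneg_of_nonpos (by positivity) (by linarith)
  have hbound : ∀ᶠ s in 𝓝[>] (0 : ℝ), f R ^ 2 * R ^ 3 ≤ C ^ 2 * s := by
    filter_upwards [Ioc_mem_nhdsGT hR] with s hs
    refine (hanti hs ⟨hR, le_refl R⟩ hs.2).trans ?_
    have h1 : (|f s| * s) ^ 2 ≤ C ^ 2 :=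
      pow_le_pow_left₀ (mul_nonneg (abs_nonneg _) hs.1.le) (hC s hs) 2
    rw [mul_pow, sq_abs] at h1
    calc f s ^ 2 * s ^ 3 = f s ^ 2 * s ^ 2 * s := by ring
      _ ≤ C ^ 2 * s := mul_le_mul_of_nonneg_right h1 hs.1.le
  have hlim : Filter.Tendsto (fun s : ℝ => C ^ 2 * s) (𝓝[>] 0) (𝓝 0) := by
    have : Filter.Tendsto (fun s : ℝ => C ^ 2 * s) (𝓝 0) (𝓝 (C ^ 2 * 0)) :=
      (continuous_const_mul (C ^ 2)).tendsto 0
    rw [mul_zero] at this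
    exact this.mono_left nhdsWithin_le_nhds
  have h0 : f R ^ 2 * R ^ 3 ≤ 0 := ge_of_tendsto hlim hbound
  have h1 : f R ^ 2 ≤ 0 := by
    by_contra h
    push Not at h
    have : 0 < f R ^ 2 * R ^ 3 := by positivity
    linarith
  nlinarith [sq_nonneg (f R)]

set_option linter.unusedSectionVars false

variable {n : ℕ} {M : Type*} [TopologicalSpace M]
  [ChartedSpace (EuclideanSpace ℝ (Fin (2 * n))) M]
  {F : M → Heis n} {e : M → Hor n} {p : M} {u : Hor n → ℝ} {φ : Hor n → M}

theorem norm_JL_le : ‖JL n‖ ≤ 1 :=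
  ContinuousLinearMap.opNorm_le_bound _ zero_le_one fun v => by
    rw [JL_apply, norm_J, one_mul]

/-- If `‖A‖ ≤ 2`, then `A v = t v` in the direction `v` forces `|t| ≤ 2`. -/
theorem abs_le_two_of_inner_eq {A : Hor n →L[ℝ] Hor n} (hA : ‖A‖ ≤ 2) {v : Hor n} (hv : v ≠ 0)
    {t : ℝ} (h : inner ℝ (A v) v = t * inner ℝ v v) : |t| ≤ 2 := by
  have h1 : |inner ℝ (A v) v| ≤ 2 * ‖v‖ * ‖v‖ :=
    (abs_real_inner_le_norm _ _).trans
      (mul_le_mul_of_nonneg_right (A.le_of_opNorm_le hA v) (norm_nonneg v))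
  rw [h, abs_mul, real_inner_self_eq_norm_sq, abs_of_nonneg (sq_nonneg ‖v‖)] at h1
  have h2 : 0 < ‖v‖ ^ 2 := by positivity
  exact le_of_mul_le_mul_right (by linarith) h2

set_option maxHeartbeats 1000000 in
/-- Near a singular point, `l = 2 k` at all regular points. -/
theorem eventually_ell_eq_of_isSingular [IsManifold (𝓡 (2 * n)) 2 M] (hn : 2 ≤ n)
    (hF : IsImmersedHypersurface F)
    (he : IsCharacteristicField F e) (humb : IsUmbilicHypersurface F e) {c : ℝ}
    (hH : ∀ p, IsRegular F p → pMeanCurvature F e p = c) (hp : IsSingular F p) :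
    ∀ᶠ q in 𝓝 p, IsRegular F q → n * ell F e q = c := by
  have hn' : (2 : ℝ) ≤ n := by exact_mod_cast hn
  obtain ⟨u, φ, hu, hφp, hφ, hinv⟩ := exists_graph hF hp
  have hgr := eventually_graph hu hφp hφ hinv hF
  have hG0 : graphGrad u (F p).1 = 0 := graphGrad_eq_zero_of_isSingular hn hF he humb hH hp hu
    (by simpa only [hφp] using hgr.self_of_nhds.2.2.2)
  have hDJ := fderiv_graphGrad_of_isSingular hn hF he humb hH hp hu hφp hφ hinv
  set z₀ := (F p).1 with hz₀
  have hGd : HasFDerivAt (graphGrad u) (JL n) z₀ := by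
    rw [← hDJ]
    exact ((contDiffAt_graphGrad hu).differentiableAt (by norm_num)).hasFDerivAt
  have hDc : ContinuousAt (fderiv ℝ (graphGrad u)) z₀ :=
    ((contDiffAt_graphGrad hu).fderiv_right (m := 0) (by norm_num)).continuousAt
  have hD2 : ∀ᶠ z in 𝓝 z₀, ‖fderiv ℝ (graphGrad u) z‖ < 2 := by
    refine hDc.norm.eventually (gt_mem_nhds ?_)
    simp only [hDJ]
    exact norm_JL_le.trans_lt one_lt_two
  -- The tolerance `1 / 16` keeps `|G|` between `15 s / 16` and `17 s / 16`, enough for `s a ≥ n ≥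
  -- 2` below, where the limiting value is `2n`.
  have hlin : ∀ᶠ z in 𝓝 z₀, ‖graphGrad u z - J n (z - z₀)‖ ≤ 1 / 16 * ‖z - z₀‖ := by
    have := hGd.isLittleO.def (c := 1 / 16) (by norm_num)
    simpa [hG0] using this
  obtain ⟨r, hr, hball⟩ := Metric.eventually_nhds_iff_ball.1 (hgr.and (hD2.and hlin))
  have main : ∀ z ∈ Metric.ball z₀ r, z ≠ z₀ → n * ell F e (φ z) = c := by
    intro z hz hne
    set R := ‖z - z₀‖ with hRdef
    have hR : 0 < R := norm_pos_iff.2 (sub_ne_zero.2 hne)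
    set σ := R⁻¹ • (z - z₀) with hσ
    have hσ1 : ‖σ‖ = 1 := by
      rw [hσ, norm_smul, norm_inv, Real.norm_of_nonneg hR.le, inv_mul_cancel₀ hR.ne']
    have hend : z₀ + R • σ = z := by
      rw [hσ, smul_inv_smul₀ hR.ne', add_sub_cancel]
    let γ : ℝ → M := fun s => φ (z₀ + s • σ)
    -- The logarithmic derivative of `n l - c` along the ray.
    let a : ℝ → ℝ := fun s => 2 * n * (alpha F e (γ s) * (inner ℝ (e (γ s)) σ -
      (c - ell F e (γ s)) / (2 * n - 2) * inner ℝ (graphGrad u (z₀ + s • σ)) σ))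
    have hall : ∀ s ∈ Set.Ioc 0 R,
        HasDerivAt (fun s => n * ell F e (γ s) - c) (-(a s * (n * ell F e (γ s) - c))) s ∧
        2 ≤ s * a s ∧ |n * ell F e (γ s) - c| * s ≤ 4 * n + |c| * R := by
      intro s hs
      have hs0 : 0 < s := hs.1
      have hsub : z₀ + s • σ - z₀ = s • σ := by abel
      have hsn : ‖z₀ + s • σ - z₀‖ = s := by
        rw [hsub, norm_smul, hσ1, mul_one, Real.norm_of_nonneg hs0.le]
      have hmem : z₀ + s • σ ∈ Metric.ball z₀ r := by
        rw [mem_ball_iff_norm, hsn]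
        exact hs.2.trans_lt (mem_ball_iff_norm.1 hz)
      obtain ⟨⟨hs1, hs2, hs3, hs4⟩, hs5, hs6⟩ := hball _ hmem
      rw [hsn, hsub, map_smul] at hs6
      set y := z₀ + s • σ with hy
      set G := graphGrad u y with hG
      have hFy : F (φ y) = (y, u y) := hs3.self_of_nhds
      have hFy1 : (F (φ y)).1 = y := by rw [hFy]
      have hsJ : ‖s • J n σ‖ = s := by
        rw [norm_smul, norm_J, hσ1, mul_one, Real.norm_of_nonneg hs0.le]
      have hGlow : 15 / 16 * s ≤ ‖G‖ := by
        have := norm_sub_norm_le (s • J n σ) (s • J n σ - G)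
        rw [sub_sub_cancel, hsJ, ← norm_neg (s • J n σ - G), neg_sub] at this
        linarith
      have hGup : ‖G‖ ≤ 17 / 16 * s := by
        have := norm_le_norm_add_norm_sub' G (s • J n σ)
        rw [hsJ] at this
        linarith
      have hGpos : 0 < ‖G‖ := lt_of_lt_of_le (by positivity) hGlow
      have hGne : G ≠ 0 := norm_pos_iff.1 hGpos
      have hGσ : |inner ℝ G σ| ≤ 1 / 16 * s := by
        have h1 : inner ℝ G σ = inner ℝ (G - s • J n σ) σ := by
          rw [inner_sub_left, real_inner_smul_left, inner_J_self']
          ring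
        rw [h1]
        refine (abs_real_inner_le_norm _ _).trans ?_
        rw [hσ1, mul_one]
        exact hs6
      have hGJσ : 15 / 16 * s ≤ inner ℝ G (J n σ) := by
        have h1 : inner ℝ G (J n σ) = s + inner ℝ (G - s • J n σ) (J n σ) := by
          rw [inner_sub_left, real_inner_smul_left, inner_J_J, real_inner_self_eq_norm_sq, hσ1]
          ring
        have h2 := (abs_real_inner_le_norm (G - s • J n σ) (J n σ))
        rw [norm_J, hσ1, mul_one] at h2
        have h3 := neg_abs_le (inner ℝ (G - s • J n σ) (J n σ))
        linarith
      obtain ⟨hreg, ε, hε, hα, hee, hf1, hf2⟩ :=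
        graph_normal_form (q := φ y) hn hF he humb hH (by rwa [hFy1]) hs4 (by rwa [hFy1])
      rw [hFy1, ← hG] at hα hee hf1 hf2
      have hεabs : |ε| = 1 := by rw [← abs_one, ← sq_eq_sq_iff_abs_eq_abs, hε, one_pow]
      set k := (c - ell F e (φ y)) / (2 * n - 2) with hk
      -- Up to sign `|G| k` and `|G| l` are Rayleigh quotients of `DG`, whose norm is below `2`. So
      -- `k` and `l` grow at most like `1 / s`.
      have hkb : |ε * ‖G‖ * k| ≤ 2 := by
        obtain ⟨v, hv0, hv1, hv2⟩ := exists_ne_zero_orthogonal hn G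
        rw [← abs_neg]
        refine abs_le_two_of_inner_eq hs5.le hv0 ?_
        rw [hf1 v v hv1 hv2 hv1, inner_J_self', add_zero]
      have hlb : |ε * ‖G‖ * ell F e (φ y)| ≤ 2 := by
        rw [← abs_neg]
        refine abs_le_two_of_inner_eq hs5.le (v := J n G) ?_ (hf2 _ (inner_J_self G))
        rwa [← norm_ne_zero_iff, norm_J, norm_ne_zero_iff]
      refine ⟨?_, ?_, ?_⟩
      · have hline : HasDerivAt (fun s : ℝ => z₀ + s • σ) σ s := by
          simpa using ((hasDerivAt_id s).smul_const σ).const_add z₀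
        have hud : DifferentiableAt ℝ u y := hs1.differentiableAt (by norm_num)
        have hX : HasDerivAt (F ∘ γ) (σ, fderiv ℝ u y σ) s := by
          have h1 : HasDerivAt (fun s : ℝ => ((z₀ + s • σ, u (z₀ + s • σ)) : Heis n))
              (σ, fderiv ℝ u y σ) s :=
            hline.prodMk (hud.hasFDerivAt.comp_hasDerivAt s hline)
          exact h1.congr_of_eventuallyEq (hline.continuousAt.eventually hs3)
        have hγ : ContinuousAt γ s :=
          ContinuousAt.comp (g := φ) (f := fun s : ℝ => z₀ + s • σ) hs2 hline.continuousAt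
        have hd := ((hasDerivAt_ell hn hF he humb hH hγ hX hreg).const_mul (n : ℝ)).sub_const c
        refine hd.congr_deriv ?_
        -- The contact form on the lifted ray is the radial component of `G`; it is small because
        -- `G` is nearly `s J σ`, which is orthogonal to `σ`.
        have hθ : contactForm (F (γ s)) (σ, fderiv ℝ u y σ) = inner ℝ G σ := by
          rw [contactForm_apply, inner_graphGrad hud, inner_J_left]
          change _ - inner ℝ (F (φ y)).1 _ = _
          rw [hFy1]
          ring
        rw [hθ]
        simp only [a]
        ring
      · have hA : alpha F e (φ y) * (inner ℝ (e (φ y)) σ - k * inner ℝ G σ) =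
            (inner ℝ G (J n σ) - ε * ‖G‖ * k * inner ℝ G σ) / ‖G‖ ^ 2 := by
          rw [hα, hee, inner_neg_left, real_inner_smul_left, inner_J_left]
          field_simp
          linear_combination (inner ℝ G (J n σ)) * hε
        have h1 : |ε * ‖G‖ * k * inner ℝ G σ| ≤ 2 * (1 / 16 * s) := by
          rw [abs_mul]
          exact mul_le_mul hkb hGσ (abs_nonneg _) zero_le_two
        have h2 : 13 / 16 * s ≤ inner ℝ G (J n σ) - ε * ‖G‖ * k * inner ℝ G σ := by
          have := le_abs_self (ε * ‖G‖ * k * inner ℝ G σ)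
          linarith
        have h3 : 1 / 2 ≤ s * (alpha F e (φ y) * (inner ℝ (e (φ y)) σ - k * inner ℝ G σ)) := by
          rw [hA, ← mul_div_assoc, le_div_iff₀ (by positivity)]
          nlinarith
        have h4 : s * a s = 2 * n *
            (s * (alpha F e (φ y) * (inner ℝ (e (φ y)) σ - k * inner ℝ G σ))) := by
          simp only [a]
          change s * (2 * n * (alpha F e (φ y) * (inner ℝ (e (φ y)) σ - k * inner ℝ G σ))) = _
          ring
        rw [h4]
        nlinarith
      · change |n * ell F e (φ y) - c| * s ≤ _
        have h1 : |ell F e (φ y)| * s ≤ 4 := by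
          rw [abs_mul, abs_mul, hεabs, one_mul, abs_norm] at hlb
          nlinarith [abs_nonneg (ell F e (φ y))]
        have h2 : |n * ell F e (φ y) - c| ≤ n * |ell F e (φ y)| + |c| := by
          refine (abs_sub _ _).trans_eq ?_
          rw [abs_mul, Nat.abs_cast]
        calc |n * ell F e (φ y) - c| * s ≤ (n * |ell F e (φ y)| + |c|) * s := by gcongr
          _ = n * (|ell F e (φ y)| * s) + |c| * s := by ring
          _ ≤ n * 4 + |c| * R := by
            gcongr
            exact hs.2
          _ = _ := by ring
    have h0 := eq_zero_of_hasDerivAt_of_le hR (fun s hs => (hall s hs).1)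
      (fun s hs => (hall s hs).2.1) (fun s hs => (hall s hs).2.2)
    simp only [γ, hend] at h0
    linarith
  have hcont : ContinuousAt (fun q => (F q).1) p :=
    (continuous_fst.comp hF.continuous).continuousAt
  filter_upwards [hcont.eventually (Metric.ball_mem_nhds z₀ hr), hinv] with q hq1 hq2 hreg
  -- Over `z₀` the sheet contains only `p`, which is singular.
  have hne : (F q).1 ≠ z₀ := by
    intro h
    rw [h, hφp] at hq2
    exact hreg (hq2 ▸ hp)
  have := main _ hq1 hne
  rwa [hq2] at this

end Radial

end Heisenberg

end

/-! ### Conclusion by connectedness. -/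

theorem lemmaB {n : ℕ} (hn : 2 ≤ n) {M : Type*} [TopologicalSpace M] [T2Space M]
    [ConnectedSpace M] [ChartedSpace (EuclideanSpace ℝ (Fin (2 * n))) M]
    [IsManifold (𝓡 (2 * n)) 2 M]
    (F : M → Heisenberg.Heis n) (hF : Heisenberg.IsImmersedHypersurface F)
    (e : M → Heisenberg.Hor n) (he : Heisenberg.IsCharacteristicField F e)
    (humb : Heisenberg.IsUmbilicHypersurface F e)
    (c : ℝ) (hc : 0 < c)
    (hH : ∀ p, Heisenberg.IsRegular F p → Heisenberg.pMeanCurvature F e p = c)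
    (hsing : ∃ p, Heisenberg.IsSingular F p) :
    ∀ p, Heisenberg.IsRegular F p →
      ∃ k : ℝ, Heisenberg.IsEigenvalue F e p k ∧ Heisenberg.ell F e p = 2 * k := by
  have hn' : (2 : ℝ) ≤ n := by exact_mod_cast hn
  -- Singular points belong to `A` vacuously. This makes `A` nonempty and lets connectedness of `M`
  -- suffice, with no need for that of the regular part.
  let A : Set M := {p | Heisenberg.IsRegular F p → n * Heisenberg.ell F e p = c}
  have hopen : IsOpen A := by
    rw [isOpen_iff_mem_nhds]
    intro p hp
    by_cases hs : Heisenberg.IsSingular F p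
    · exact Heisenberg.eventually_ell_eq_of_isSingular hn hF he humb hH hs
    · filter_upwards [Heisenberg.eventually_ell_eq hn hF he humb hH hs (hp hs)] with q hq _
      exact hq
  have hclosed : IsClosed A := by
    rw [← isOpen_compl_iff, isOpen_iff_mem_nhds]
    intro p hp
    obtain ⟨hreg, hne⟩ := Classical.not_imp.1 hp
    have hcont : ContinuousAt (fun q => n * Heisenberg.ell F e q) p :=
      continuousAt_const.mul (Heisenberg.continuousAt_ell hF he hreg)
    filter_upwards [Heisenberg.eventually_isRegular hF he hreg, hcont.eventually_ne hne]
      with q h1 h2 h3 using h2 (h3 h1)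
  have huniv : A = Set.univ := by
    obtain ⟨p₀, hp₀⟩ := hsing
    exact IsClopen.eq_univ ⟨hclosed, hopen⟩ ⟨p₀, fun h => absurd hp₀ h⟩
  intro p hp
  have hl : n * Heisenberg.ell F e p = c := (huniv ▸ Set.mem_univ p : p ∈ A) hp
  obtain ⟨U, -, h⟩ := Heisenberg.exists_smooth_isAdapted he hF hp
  obtain ⟨k, hk, -, -, h3⟩ := h.exists_normal_form hn hF (humb p hp)
  rw [hH p hp, ← hl] at h3
  refine ⟨k, hk, ?_⟩
  -- With `c = n l`, the trace formula reads `(n - 1) l = (2n - 2) k`.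
  have hn1 : (n - 1 : ℝ) ≠ 0 := by linarith
  apply mul_left_cancel₀ hn1
  linear_combination h3
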